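/- **Setting.** Let $\Omega\subset\mathbb R^2$ be a bounded polygonal domain (connected), let $\Gamma_D\subset\partial\Omega$ be a measurable part of the boundary with positive arc length, let $D$ be a symmetric positive definite real $3\times3$ matrix, and put $$V=\{u\in (H^1(\Omega))^2 : u=0 \text{ on }\Gamma_D\},\qquad W=(L^2(\Omega))^3,\qquad Bu=(\partial_x u_1,\ \partial_y u_2,\ \partial_y u_1+\partial_x u_2)^T .$$ Let $f$ be a continuous linear functional on $V$ (for instance $f(u)=\int_\Omega b\cdot u\,d\Omega+\int_{\partial\Omega\setminus\Gamma_D}t\cdot u\,d\Gamma$ for a body force $b$ and a traction $t$), and let $:$ be the Euclidean inner product of $\mathbb R^3$. The *five-field variational principle* asks for $(u,\epsilon_1,\epsilon_2,\sigma_1,\sigma_2)\in V\times W\times W\times W\times W$ such that for all $v\in V$ and $\delta_1,\delta_2,\tau_1,\tau_2\in W$ $$\int_\Omega \sigma_1: Bv\,d\Omega+\int_\Omega(-\sigma_1+\sigma_2):\delta_1\,d\Omega+\int_\Omega(D\epsilon_2-\sigma_2):\delta_2\,d\Omega=f(v),\qquad \int_\Omega\tau_1:(Bu-\epsilon_1)\,d\Omega+\int_\Omega\tau_2:(\epsilon_1-\epsilon_2)\,d\Omega=0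 .$$ **Meshes and discrete spaces.** Let $\mathcal T_h$ be a finite conforming mesh of $\Omega$, consisting either of nondegenerate triangles or of strictly convex quadrilaterals (two different closed elements are disjoint or meet in exactly one common vertex or one common edge). The center of an element is the mean of its vertices; joining it to the vertices divides the element into subtriangles, one for each edge. * $V_h\subset V$ consists of the continuous functions in $V$ that are affine on every element (triangles), respectively affine on the four subtriangles of every element with value at the center equal to the mean of the values at the four vertices (quadrilaterals). * $\mathcal T_{1,h}$ has one cell for every edge $e$ of the mesh: the union of the subtriangles on $e$ of the elements having $e$ as an edge. It is the quadrilateral formed by the endpoints of $e$ and the centers of the two adjacent elements if $e$ is interior, and a single subtriangle if $e\subset\partial\Omega$. * $\mathcal T_{2,h}$ has one cell for every vertex $x$ of every element $T$: the quadrilateral formed by the center of $T$, the vertex $x$, and the midpoints of the two edges of $T$ that meet at $x$. * For $k=1,2$, $W_{k,h}\subset W$ is the space of fields that are constant on each cell of $\mathcal T_{k,h}$, and $P_{k,h}:W\to W_{k,h}$ is $(P_{k,h}\epsilon)|_T=\frac1{|T|}\int_T\epsilon\,d\Omega$ for $T\in\mathcal T_{k,h}$. **Theorem.** The Galerkin approximation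 of the five-field principle, obtained by replacing $V$ by $V_h$ and the four copies of $W$ by $W_{1,h},W_{2,h},W_{1,h},W_{2,h}$ for trial and test functions alike, has a unique solution $(\bar u_h,\epsilon_{1,h},\epsilon_{2,h},\sigma_{1,h},\sigma_{2,h})\in V_h\times W_{1,h}\times W_{2,h}\times W_{1,h}\times W_{2,h}$. It satisfies $$\epsilon_{1,h}=P_{1,h}(B\bar u_h),\qquad \epsilon_{2,h}=P_{2,h}P_{1,h}(B\bar u_h),\qquad \sigma_{1,h}=P_{1,h}P_{2,h}\bigl(D\,P_{2,h}P_{1,h}(B\bar u_h)\bigr),\qquad \sigma_{2,h}=D\,P_{2,h}P_{1,h}(B\bar u_h),$$ and $\bar u_h$ is the unique solution of the strain-smoothed element (SSE) method: find $\bar u_h\in V_h$ such that $$\int_\Omega D\,P_{2,h}P_{1,h}(B\bar u_h): P_{2,h}P_{1,h}(Bv)\,d\Omega=f(v)\qquad\text{for all } v\in V_h .$$ Hence the SSE method is a conforming Galerkin approximation of the five-field principle. -/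

import Mathlib

open MeasureTheory Set Filter Topology
open scoped ENNReal ContDiff

noncomputable section

/-! ### The plane, Voigt vectors, and `L²` fields -/

/-- The plane `ℝ²`; also the values of displacement fields. -/
abbrev Plane : Type := EuclideanSpace ℝ (Fin 2)

/-- Voigt vectors in `ℝ³` with the Euclidean inner product. -/
abbrev Voigt : Type := EuclideanSpace ℝ (Fin 3)

/-- `(L²(Ω))²`. -/
abbrev DispL2 (Ω : Set Plane) : Type := Lp Plane 2 (volume.restrict Ω)

/-- The space `W = (L²(Ω))³` of strain and stress fields. -/
abbrev StrainL2 (Ω : Set Plane) : Type := Lp Voigt 2 (volume.restrict Ω)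

/-- The pairing `∫_Ω σ : τ dΩ`. -/
def pairing {Ω : Set Plane} (σ τ : StrainL2 Ω) : ℝ :=
  ∫ x in Ω, inner ℝ (σ x) (τ x)

/-- The field `D ε` for a constant `3 × 3` matrix `D`. -/
def matMul {Ω : Set Plane} (D : Matrix (Fin 3) (Fin 3) ℝ) (ε : StrainL2 Ω) : StrainL2 Ω :=
  (Matrix.toEuclideanCLM (𝕜 := ℝ) D).compLp ε

/-! ### The Sobolev space `H¹(Ω)²` and the Dirichlet condition -/

/-- `φ` is a (scalar) test function on `Ω`. -/
def IsTestFunction (Ω : Set Plane) (φ : Plane → ℝ) : Prop :=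
  ContDiff ℝ ∞ φ ∧ HasCompactSupport φ ∧ tsupport φ ⊆ Ω

/-- The partial derivative `∂_j φ` of a differentiable function. -/
def partialDeriv {F : Type*} [NormedAddCommGroup F] [NormedSpace ℝ F]
    (j : Fin 2) (φ : Plane → F) (x : Plane) : F :=
  fderiv ℝ φ x (EuclideanSpace.single j 1)

/-- `g` is the weak partial derivative `∂_j u` on `Ω`. -/
def IsWeakPartial {Ω : Set Plane} (j : Fin 2) (u g : DispL2 Ω) : Prop :=
  ∀ φ : Plane → ℝ, IsTestFunction Ω φ →
    ∫ x in Ω, partialDeriv j φ x • u x = -∫ x in Ω, φ x • g x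

theorem IsTestFunction.integrable_smul {Ω : Set Plane} {φ : Plane → ℝ}
    (hφ : IsTestFunction Ω φ) (u : DispL2 Ω) :
    Integrable (fun x => φ x • u x) (volume.restrict Ω) := by
  have h1 : MemLp φ 2 (volume.restrict Ω) :=
    (hφ.1.continuous.memLp_of_hasCompactSupport (μ := volume) hφ.2.1).restrict Ω
  exact memLp_one_iff_integrable.1 ((Lp.memLp u).smul h1)

theorem IsTestFunction.integrable_partialDeriv_smul {Ω : Set Plane} {φ : Plane → ℝ}
    (hφ : IsTestFunction Ω φ) (j : Fin 2) (u : DispL2 Ω) :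
    Integrable (fun x => partialDeriv j φ x • u x) (volume.restrict Ω) := by
  have hc : Continuous (partialDeriv j φ) :=
    (hφ.1.continuous_fderiv (by simp)).clm_apply continuous_const
  have hs : HasCompactSupport (partialDeriv j φ) :=
    hφ.2.1.fderiv_apply (𝕜 := ℝ) _
  have h1 : MemLp (partialDeriv j φ) 2 (volume.restrict Ω) :=
    (hc.memLp_of_hasCompactSupport (μ := volume) hs).restrict Ω
  exact memLp_one_iff_integrable.1 ((Lp.memLp u).smul h1)

/-- `(H¹(Ω))²`, an element being a field `u ∈ (L²(Ω))²` together with its weak partial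
derivatives `∂₀ u, ∂₁ u ∈ (L²(Ω))²` (which `u` determines when `Ω` is open).  The topology is that
of the graph norm, i.e. of the `H¹` norm. -/
def H1 (Ω : Set Plane) : Submodule ℝ (DispL2 Ω × (Fin 2 → DispL2 Ω)) where
  carrier := {U | ∀ j, IsWeakPartial j U.1 (U.2 j)}
  zero_mem' := by
    intro j φ _
    have h : ∀ᵐ x ∂(volume.restrict Ω), (0 : DispL2 Ω) x = 0 := Lp.coeFn_zero _ _ _
    have h1 : ∀ ψ : Plane → ℝ, ∫ x in Ω, ψ x • (0 : DispL2 Ω) x = 0 := fun ψ =>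
      integral_eq_zero_of_ae (h.mono fun x hx => by
        change ψ x • (0 : DispL2 Ω) x = 0
        rw [hx, smul_zero])
    change ∫ x in Ω, partialDeriv j φ x • (0 : DispL2 Ω) x = -∫ x in Ω, φ x • (0 : DispL2 Ω) x
    rw [h1, h1, neg_zero]
  add_mem' := by
    intro U U' hU hU' j φ hφ
    have e : ∀ (ψ : Plane → ℝ) (u u' : DispL2 Ω),
        (fun x => ψ x • (u + u') x) =ᵐ[volume.restrict Ω] fun x => ψ x • u x + ψ x • u' x :=
      fun ψ u u' => (Lp.coeFn_add u u').mono fun x hx => by simp only [hx, Pi.add_apply, smul_add]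
    change ∫ x in Ω, partialDeriv j φ x • (U.1 + U'.1) x = -∫ x in Ω, φ x • (U.2 j + U'.2 j) x
    rw [integral_congr_ae (e _ _ _), integral_congr_ae (e _ _ _),
      integral_add (hφ.integrable_partialDeriv_smul j _) (hφ.integrable_partialDeriv_smul j _),
      integral_add (hφ.integrable_smul _) (hφ.integrable_smul _), hU j φ hφ, hU' j φ hφ, neg_add]
  smul_mem' := by
    intro c U hU j φ hφ
    have e : ∀ (ψ : Plane → ℝ) (u : DispL2 Ω),
        (fun x => ψ x • (c • u) x) =ᵐ[volume.restrict Ω] fun x => c • ψ x • u x :=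
      fun ψ u => (Lp.coeFn_smul c u).mono fun x hx => by
        simp only [hx, Pi.smul_apply, smul_comm c]
    change ∫ x in Ω, partialDeriv j φ x • (c • U.1) x = -∫ x in Ω, φ x • (c • U.2 j) x
    rw [integral_congr_ae (e _ _), integral_congr_ae (e _ _), integral_smul, integral_smul,
      hU j φ hφ, smul_neg]

/-- The underlying field `u ∈ (L²(Ω))²`. -/
def H1.val {Ω : Set Plane} (U : H1 Ω) : DispL2 Ω := U.1.1

/-- The weak partial derivative `∂_j u ∈ (L²(Ω))²`. -/
def H1.partial {Ω : Set Plane} (U : H1 Ω) (j : Fin 2) : DispL2 Ω := U.1.2 j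

/-- `u = 0` on `Γ` in the sense of traces: `u` is the limit in `H¹(Ω)` of smooth fields on `ℝ²`
whose restrictions to `Γ` tend to `0` in `L²(Γ)`, for the arc length measure on `Γ`. -/
def HasZeroTrace {Ω : Set Plane} (Γ : Set Plane) (U : H1 Ω) : Prop :=
  ∃ φ : ℕ → Plane → Plane, (∀ n, ContDiff ℝ ∞ (φ n)) ∧
    Tendsto (fun n => eLpNorm (fun x => φ n x - H1.val U x) 2 (volume.restrict Ω)) atTop (𝓝 0) ∧
    (∀ j, Tendsto (fun n => eLpNorm (fun x => partialDeriv j (φ n) x - H1.partial U j x) 2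
      (volume.restrict Ω)) atTop (𝓝 0)) ∧
    Tendsto (fun n => eLpNorm (φ n) 2 (Measure.hausdorffMeasure 1 |>.restrict Γ)) atTop (𝓝 0)

theorem tendsto_eLpNorm_add_zero {μ : Measure Plane} {f g h : ℕ → Plane → Plane}
    (hf : ∀ n, AEStronglyMeasurable (f n) μ) (hg : ∀ n, AEStronglyMeasurable (g n) μ)
    (hF : Tendsto (fun n => eLpNorm (f n) 2 μ) atTop (𝓝 0))
    (hG : Tendsto (fun n => eLpNorm (g n) 2 μ) atTop (𝓝 0))
    (hh : ∀ n, h n =ᵐ[μ] f n + g n) :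
    Tendsto (fun n => eLpNorm (h n) 2 μ) atTop (𝓝 0) := by
  have hs := hF.add hG
  rw [add_zero] at hs
  refine tendsto_of_tendsto_of_tendsto_of_le_of_le tendsto_const_nhds hs (fun _ => zero_le) ?_
  intro n
  change eLpNorm (h n) 2 μ ≤ _
  rw [eLpNorm_congr_ae (hh n)]
  exact eLpNorm_add_le (hf n) (hg n) (by norm_num)

theorem tendsto_eLpNorm_smul_zero {μ : Measure Plane} {f h : ℕ → Plane → Plane} (c : ℝ)
    (hF : Tendsto (fun n => eLpNorm (f n) 2 μ) atTop (𝓝 0))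
    (hh : ∀ n, h n =ᵐ[μ] c • f n) :
    Tendsto (fun n => eLpNorm (h n) 2 μ) atTop (𝓝 0) := by
  have hs := ENNReal.Tendsto.const_mul (a := ‖c‖ₑ) hF (Or.inr (by simp))
  rw [mul_zero] at hs
  refine hs.congr fun n => ?_
  rw [eLpNorm_congr_ae (hh n), eLpNorm_const_smul]

theorem continuous_partialDeriv {φ : Plane → Plane} (hφ : ContDiff ℝ ∞ φ) (j : Fin 2) :
    Continuous (partialDeriv j φ) :=
  (hφ.continuous_fderiv (by simp)).clm_apply continuous_const

/-- The space `V = {u ∈ (H¹(Ω))² : u = 0 on Γ_D}` of kinematically admissible displacements. -/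
def AdmissibleDisp (Ω ΓD : Set Plane) : Submodule ℝ (H1 Ω) where
  carrier := {U | HasZeroTrace ΓD U}
  zero_mem' := by
    refine ⟨fun _ _ => 0, fun _ => contDiff_const, ?_, ?_, by simp⟩
    · have h : (fun x => (0 : Plane) - H1.val (0 : H1 Ω) x) =ᵐ[volume.restrict Ω] 0 :=
        (Lp.coeFn_zero Plane 2 (volume.restrict Ω)).mono fun x hx => by
          change (0 : Plane) - (0 : DispL2 Ω) x = 0
          rw [hx]; simp
      simp only [eLpNorm_congr_ae h, eLpNorm_zero, tendsto_const_nhds]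
    · intro j
      have h : (fun x => partialDeriv j (fun _ : Plane => (0 : Plane)) x
          - H1.partial (0 : H1 Ω) j x) =ᵐ[volume.restrict Ω] 0 :=
        (Lp.coeFn_zero Plane 2 (volume.restrict Ω)).mono fun x hx => by
          change partialDeriv j (fun _ : Plane => (0 : Plane)) x - (0 : DispL2 Ω) x = 0
          rw [hx]; simp [partialDeriv]
      simp only [eLpNorm_congr_ae h, eLpNorm_zero, tendsto_const_nhds]
  add_mem' := by
    rintro U U' ⟨φ, hφ, h0, h1, h2⟩ ⟨ψ, hψ, k0, k1, k2⟩
    have ms : ∀ (χ : Plane → Plane), Continuous χ → ∀ u : DispL2 Ω,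
        AEStronglyMeasurable (fun x => χ x - u x) (volume.restrict Ω) := fun χ hχ u =>
      hχ.aestronglyMeasurable.sub (Lp.aestronglyMeasurable u)
    refine ⟨fun n x => φ n x + ψ n x, fun n => (hφ n).add (hψ n), ?_, fun j => ?_, ?_⟩
    · refine tendsto_eLpNorm_add_zero (fun n => ms _ (hφ n).continuous _)
        (fun n => ms _ (hψ n).continuous _) h0 k0 fun n => ?_
      refine (Lp.coeFn_add (H1.val U) (H1.val U')).mono fun x hx => ?_
      change φ n x + ψ n x - (H1.val U + H1.val U' : DispL2 Ω) x
        = (φ n x - H1.val U x) + (ψ n x - H1.val U' x)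
      rw [hx, Pi.add_apply]; abel
    · refine tendsto_eLpNorm_add_zero (fun n => ms _ (continuous_partialDeriv (hφ n) j) _)
        (fun n => ms _ (continuous_partialDeriv (hψ n) j) _) (h1 j) (k1 j) fun n => ?_
      refine (Lp.coeFn_add (H1.partial U j) (H1.partial U' j)).mono fun x hx => ?_
      change partialDeriv j (fun x => φ n x + ψ n x) x
          - (H1.partial U j + H1.partial U' j : DispL2 Ω) x
        = (partialDeriv j (φ n) x - H1.partial U j x)
          + (partialDeriv j (ψ n) x - H1.partial U' j x)
      have e : partialDeriv j (fun x => φ n x + ψ n x) x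
          = partialDeriv j (φ n) x + partialDeriv j (ψ n) x := by
        unfold partialDeriv
        rw [fderiv_fun_add ((hφ n).differentiable (by simp) x)
          ((hψ n).differentiable (by simp) x), add_apply]
      rw [hx, Pi.add_apply, e]; abel
    · exact tendsto_eLpNorm_add_zero (fun n => (hφ n).continuous.aestronglyMeasurable)
        (fun n => (hψ n).continuous.aestronglyMeasurable) h2 k2 fun n => Eventually.of_forall
          fun x => rfl
  smul_mem' := by
    rintro c U ⟨φ, hφ, h0, h1, h2⟩
    refine ⟨fun n x => c • φ n x, fun n => (hφ n).const_smul c, ?_, fun j => ?_, ?_⟩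
    · refine tendsto_eLpNorm_smul_zero c h0 fun n => ?_
      refine (Lp.coeFn_smul c (H1.val U)).mono fun x hx => ?_
      change c • φ n x - (c • H1.val U : DispL2 Ω) x = c • (φ n x - H1.val U x)
      rw [hx, Pi.smul_apply, smul_sub]
    · refine tendsto_eLpNorm_smul_zero c (h1 j) fun n => ?_
      refine (Lp.coeFn_smul c (H1.partial U j)).mono fun x hx => ?_
      change partialDeriv j (fun x => c • φ n x) x - (c • H1.partial U j : DispL2 Ω) x
        = c • (partialDeriv j (φ n) x - H1.partial U j x)
      have e : partialDeriv j (fun x => c • φ n x) x = c • partialDeriv j (φ n) x := by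
        unfold partialDeriv
        rw [fderiv_fun_const_smul ((hφ n).differentiable (by simp) x), smul_apply]
      rw [hx, Pi.smul_apply, e, smul_sub]
    · exact tendsto_eLpNorm_smul_zero c h2 fun n => Eventually.of_forall fun x => rfl

/-- The strain `B u = (∂₀ u₀, ∂₁ u₁, ∂₁ u₀ + ∂₀ u₁)`, i.e. `B = B₀ ∂₀ + B₁ ∂₁`. -/
def strain {Ω : Set Plane} (U : H1 Ω) : StrainL2 Ω :=
  (Matrix.toLpLin 2 2 !![(1 : ℝ), 0; 0, 0; 0, 1]).toContinuousLinearMap.compLp (H1.partial U 0) +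
  (Matrix.toLpLin 2 2 !![(0 : ℝ), 0; 0, 1; 1, 0]).toContinuousLinearMap.compLp (H1.partial U 1)

/-! ### The five-field variational principle -/

/-- The variational principle with one displacement field, two strain fields and two stress fields,
posed on subspaces `X ⊆ V` and `Y₁, Y₂ ⊆ W`.  The principle itself is the case `X = V` and
`Y₁ = Y₂ = W`; other choices of the subspaces are its conforming Galerkin approximations. -/
def IsFiveFieldSolution {Ω ΓD : Set Plane} (D : Matrix (Fin 3) (Fin 3) ℝ)
    (f : AdmissibleDisp Ω ΓD →L[ℝ] ℝ)
    (X : Submodule ℝ (AdmissibleDisp Ω ΓD)) (Y₁ Y₂ : Submodule ℝ (StrainL2 Ω))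
    (u : X) (ε₁ : Y₁) (ε₂ : Y₂) (σ₁ : Y₁) (σ₂ : Y₂) : Prop :=
  (∀ (v : X) (δ₁ : Y₁) (δ₂ : Y₂),
    pairing (σ₁ : StrainL2 Ω) (strain ((v : AdmissibleDisp Ω ΓD) : H1 Ω))
      + pairing (-(σ₁ : StrainL2 Ω) + (σ₂ : StrainL2 Ω)) (δ₁ : StrainL2 Ω)
      + pairing (matMul D (ε₂ : StrainL2 Ω) - (σ₂ : StrainL2 Ω)) (δ₂ : StrainL2 Ω)
      = f (v : AdmissibleDisp Ω ΓD)) ∧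
  (∀ (τ₁ : Y₁) (τ₂ : Y₂),
    pairing (τ₁ : StrainL2 Ω) (strain ((u : AdmissibleDisp Ω ΓD) : H1 Ω) - (ε₁ : StrainL2 Ω))
      + pairing (τ₂ : StrainL2 Ω) ((ε₁ : StrainL2 Ω) - (ε₂ : StrainL2 Ω)) = 0)

/-! ### Meshes of triangles (`m = 3`) and of convex quadrilaterals (`m = 4`) -/

section Cells

variable {m : ℕ} [NeZero m] {ι : Type} (vert : ι → Fin m → Plane)

/-- The element with (cyclically ordered) vertices `vert i j`. -/
def element (i : ι) : Set Plane := convexHull ℝ (range (vert i))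

/-- The `j`-th edge of the `i`-th element, joining its vertices `j` and `j + 1` (modulo `m`). -/
def edge (i : ι) (j : Fin m) : Set Plane := segment ℝ (vert i j) (vert i (j + 1))

/-- The center of an element, the mean of its vertices: the centroid of a triangle, and the point
`r = s = 0` of a quadrilateral in bilinear coordinates. -/
def center (i : ι) : Plane := (m : ℝ)⁻¹ • ∑ j, vert i j

/-- The subtriangle spanned by the center of an element and its `j`-th edge. -/
def subTriangle (i : ι) (j : Fin m) : Set Plane :=
  convexHull ℝ {center vert i, vert i j, vert i (j + 1)}

/-- The cell of `𝒯_{1,h}` around the `j`-th edge of the `i`-th element: the union of the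
subtriangles on that edge, one for each element that has this edge.  For an interior edge this is
the quadrilateral formed by the endpoints of the edge and the centers of its two elements, and for
an edge on the boundary it is the single subtriangle on the edge. -/
def edgeCell (p : ι × Fin m) : Set Plane :=
  ⋃ q ∈ {q : ι × Fin m | edge vert q.1 q.2 = edge vert p.1 p.2}, subTriangle vert q.1 q.2

/-- The cell of `𝒯_{2,h}` at the `j`-th vertex of the `i`-th element: the quadrilateral formed by
the center of the element, the vertex, and the midpoints of the two edges meeting there. -/
def vertexCell (p : ι × Fin m) : Set Plane :=
  convexHull ℝ {center vert p.1, midpoint ℝ (vert p.1 (p.2 - 1)) (vert p.1 p.2), vert p.1 p.2,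
    midpoint ℝ (vert p.1 p.2) (vert p.1 (p.2 + 1))}

end Cells

/-- The cross product of two vectors of the plane. -/
def cross (a b : Plane) : ℝ := a 0 * b 1 - a 1 * b 0

/-- A conforming mesh of the domain `Ω` by nondegenerate triangles (`m = 3`) or strictly convex
quadrilaterals (`m = 4`), the vertices of each element being listed counterclockwise: `Ω` is the
interior of the union of the closed elements, and two different elements are disjoint or meet in
exactly one common vertex or in exactly one common edge (which they traverse in opposite
directions). -/
structure Mesh (m : ℕ) [NeZero m] (ι : Type) (Ω : Set Plane) where
  vert : ι → Fin m → Plane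
  convex : ∀ i j, 0 < cross (vert i (j + 1) - vert i j) (vert i (j + 2) - vert i (j + 1))
  cover : interior (⋃ i, element vert i) = Ω
  conforming : ∀ i i', i ≠ i' →
    Disjoint (element vert i) (element vert i') ∨
    (∃ j j', vert i j = vert i' j' ∧ element vert i ∩ element vert i' = {vert i j}) ∨
    (∃ j j', vert i j = vert i' (j' + 1) ∧ vert i (j + 1) = vert i' j' ∧
      element vert i ∩ element vert i' = edge vert i j)

/-! ### Piecewise constant fields and the smoothing operators -/

/-- A finite collection of measurable cells in the plane. -/
structure Subdivision where
  cells : Finset (Set Plane)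
  measurable : ∀ T ∈ cells, MeasurableSet T

/-- The space of fields in `(L²(Ω))³` that are constant (almost everywhere) on each cell. -/
def piecewiseConst (Ω : Set Plane) (S : Subdivision) : Submodule ℝ (StrainL2 Ω) where
  carrier := {ε | ∀ T ∈ S.cells, ∃ c : Voigt, ∀ᵐ x ∂(volume.restrict Ω), x ∈ T → ε x = c}
  zero_mem' := fun T _ => ⟨0, (Lp.coeFn_zero Voigt 2 (volume.restrict Ω)).mono fun x hx _ => hx⟩
  add_mem' := by
    intro ε δ hε hδ T hT
    obtain ⟨c, hc⟩ := hε T hT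
    obtain ⟨d, hd⟩ := hδ T hT
    refine ⟨c + d, ?_⟩
    filter_upwards [hc, hd, Lp.coeFn_add ε δ] with x h1 h2 h3 hx
    rw [h3, Pi.add_apply, h1 hx, h2 hx]
  smul_mem' := by
    intro a ε hε T hT
    obtain ⟨c, hc⟩ := hε T hT
    refine ⟨a • c, ?_⟩
    filter_upwards [hc, Lp.coeFn_smul a ε] with x h1 h3 hx
    rw [h3, Pi.smul_apply, h1 hx]

/-- The field with value `|T|⁻¹ ∫_T ε dΩ` on each cell `T` (cells overlap in null sets only). -/
def cellMean {Ω : Set Plane} (S : Subdivision) (ε : StrainL2 Ω) (x : Plane) : Voigt :=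
  ∑ T ∈ S.cells, T.indicator (fun _ => ⨍ y in T, ε y ∂(volume.restrict Ω)) x

theorem memLp_cellMean {Ω : Set Plane} (S : Subdivision) (ε : StrainL2 Ω) :
    MemLp (cellMean S ε) 2 (volume.restrict Ω) := by
  unfold cellMean
  refine memLp_finsetSum S.cells fun T hT => ?_
  by_cases h : (volume.restrict Ω) T = ⊤
  · have h0 : (⨍ y in T, ε y ∂(volume.restrict Ω)) = 0 := by
      rw [setAverage_eq, measureReal_def, h]; simp
    simp only [h0, indicator_zero]
    exact MemLp.zero
  · exact memLp_indicator_const 2 (S.measurable T hT) _ (Or.inr h)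

/-- The piecewise smoothing operator `P : (L²(Ω))³ → (L²(Ω))³` of a subdivision. -/
def smoothing {Ω : Set Plane} (S : Subdivision) (ε : StrainL2 Ω) : StrainL2 Ω :=
  (memLp_cellMean S ε).toLp

theorem measurableSet_convexHull_finite {s : Set Plane} (hs : s.Finite) :
    MeasurableSet (convexHull ℝ s) :=
  (hs.isCompact_convexHull (𝕜 := ℝ)).isClosed.measurableSet

section MeshSpaces

variable {m : ℕ} [NeZero m] {ι : Type} [Fintype ι] {Ω : Set Plane}

open Classical in
/-- The subdivision `𝒯_{1,h}`. -/
def Mesh.edgeSubdivision (M : Mesh m ι Ω) : Subdivision where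
  cells := Finset.univ.image (edgeCell M.vert)
  measurable := by
    intro T hT
    obtain ⟨p, -, rfl⟩ := Finset.mem_image.1 hT
    exact MeasurableSet.biUnion (to_countable _) fun q _ =>
      measurableSet_convexHull_finite (toFinite _)

open Classical in
/-- The subdivision `𝒯_{2,h}`. -/
def Mesh.vertexSubdivision (M : Mesh m ι Ω) : Subdivision where
  cells := Finset.univ.image (vertexCell M.vert)
  measurable := by
    intro T hT
    obtain ⟨p, -, rfl⟩ := Finset.mem_image.1 hT
    exact measurableSet_convexHull_finite (toFinite _)

/-- The discrete space `W_{1,h}`. -/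
abbrev Mesh.W₁ (M : Mesh m ι Ω) : Submodule ℝ (StrainL2 Ω) := piecewiseConst Ω M.edgeSubdivision

/-- The discrete space `W_{2,h}`. -/
abbrev Mesh.W₂ (M : Mesh m ι Ω) : Submodule ℝ (StrainL2 Ω) := piecewiseConst Ω M.vertexSubdivision

/-- The smoothing operator `P_{1,h}`. -/
def Mesh.P₁ (M : Mesh m ι Ω) (ε : StrainL2 Ω) : StrainL2 Ω := smoothing M.edgeSubdivision ε

/-- The smoothing operator `P_{2,h}`. -/
def Mesh.P₂ (M : Mesh m ι Ω) (ε : StrainL2 Ω) : StrainL2 Ω := smoothing M.vertexSubdivision ε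

/-- `w` is affine on the set `K`. -/
def IsAffineOn (w : Plane → Plane) (K : Set Plane) : Prop :=
  ∃ A : Plane →ᵃ[ℝ] Plane, EqOn w A K


/-- The finite element fields of a mesh: continuous on the closed domain and, for triangles
(`m = 3`), affine on every element; for quadrilaterals (`m = 4`), affine on the four subtriangles
of every element, with value at the center equal to the mean of the values at the vertices. -/
structure Mesh.IsElementField (M : Mesh m ι Ω) (w : Plane → Plane) : Prop where
  continuousOn : ContinuousOn w (closure Ω)
  triangle : m = 3 → ∀ i, IsAffineOn w (element M.vert i)
  quadrilateral : m = 4 → ∀ i, (∀ j, IsAffineOn w (subTriangle M.vert i j)) ∧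
    w (center M.vert i) = (1 / 4 : ℝ) • ∑ j, w (M.vert i j)

theorem IsAffineOn.add {w w' : Plane → Plane} {K : Set Plane} (h : IsAffineOn w K)
    (h' : IsAffineOn w' K) : IsAffineOn (w + w') K := by
  obtain ⟨A, hA⟩ := h
  obtain ⟨A', hA'⟩ := h'
  exact ⟨A + A', fun x hx => by simp [hA hx, hA' hx]⟩

theorem IsAffineOn.smul {w : Plane → Plane} {K : Set Plane} (c : ℝ) (h : IsAffineOn w K) :
    IsAffineOn (c • w) K := by
  obtain ⟨A, hA⟩ := h
  exact ⟨c • A, fun x hx => by simp [hA hx]⟩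

/-- The discrete displacement space `V_h ⊆ V`: the members of `V` that are represented by a finite
element field of the mesh vanishing on `Γ_D` (up to a set of arc length zero). -/
def Mesh.Vh (M : Mesh m ι Ω) (ΓD : Set Plane) : Submodule ℝ (AdmissibleDisp Ω ΓD) where
  carrier := {U | ∃ w : Plane → Plane, M.IsElementField w ∧
    (∀ᵐ x ∂(volume.restrict Ω), H1.val (U : H1 Ω) x = w x) ∧
    ∀ᵐ x ∂((Measure.hausdorffMeasure 1).restrict ΓD), w x = 0}
  zero_mem' := by
    refine ⟨0, ⟨continuousOn_const, fun _ i => ⟨0, fun _ _ => rfl⟩,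
      fun _ i => ⟨fun j => ⟨0, fun _ _ => rfl⟩, by simp⟩⟩, ?_, Eventually.of_forall fun _ => rfl⟩
    exact Lp.coeFn_zero Plane 2 (volume.restrict Ω)
  add_mem' := by
    rintro U U' ⟨w, hw, h1, h2⟩ ⟨w', hw', h1', h2'⟩
    refine ⟨w + w', ⟨hw.continuousOn.add hw'.continuousOn,
      fun h i => (hw.triangle h i).add (hw'.triangle h i), fun h i =>
      ⟨fun j => ((hw.quadrilateral h i).1 j).add ((hw'.quadrilateral h i).1 j), ?_⟩⟩, ?_, ?_⟩
    · simp only [Pi.add_apply, (hw.quadrilateral h i).2, (hw'.quadrilateral h i).2,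
        Finset.sum_add_distrib, smul_add]
    · filter_upwards [h1, h1', Lp.coeFn_add (H1.val (U : H1 Ω)) (H1.val (U' : H1 Ω))]
        with x e1 e2 e3
      rw [Pi.add_apply, ← e1, ← e2]
      exact e3
    · filter_upwards [h2, h2'] with x e1 e2
      rw [Pi.add_apply, e1, e2, add_zero]
  smul_mem' := by
    rintro c U ⟨w, hw, h1, h2⟩
    refine ⟨c • w, ⟨hw.continuousOn.const_smul c,
      fun h i => (hw.triangle h i).smul c, fun h i =>
      ⟨fun j => ((hw.quadrilateral h i).1 j).smul c, ?_⟩⟩, ?_, ?_⟩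
    · simp only [Pi.smul_apply, (hw.quadrilateral h i).2, ← Finset.smul_sum]
      rw [smul_comm]
    · filter_upwards [h1, Lp.coeFn_smul c (H1.val (U : H1 Ω))] with x e1 e3
      rw [Pi.smul_apply, ← e1]
      exact e3
    · filter_upwards [h2] with x e1
      rw [Pi.smul_apply, e1, smul_zero]

/-! ### The Galerkin approximation and the strain-smoothed element method -/

variable {ΓD : Set Plane}

/-- The strain `B v ∈ W` of a discrete displacement `v ∈ V_h`. -/
def Mesh.strainVh (M : Mesh m ι Ω) (v : M.Vh ΓD) : StrainL2 Ω :=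
  strain ((v : AdmissibleDisp Ω ΓD) : H1 Ω)

/-- The Galerkin approximation of the five-field principle on the subspaces
`V_h ⊆ V` and `W_{1,h}, W_{2,h} ⊆ W`. -/
def Mesh.IsGalerkinSolution (M : Mesh m ι Ω) (D : Matrix (Fin 3) (Fin 3) ℝ)
    (f : AdmissibleDisp Ω ΓD →L[ℝ] ℝ) (u : M.Vh ΓD) (ε₁ : M.W₁) (ε₂ : M.W₂)
    (σ₁ : M.W₁) (σ₂ : M.W₂) : Prop :=
  IsFiveFieldSolution D f (M.Vh ΓD) M.W₁ M.W₂ u ε₁ ε₂ σ₁ σ₂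

/-- The bilinear form `∫_Ω D P₂ P₁ (B u) : P₂ P₁ (B v) dΩ` on `V_h`. -/
def Mesh.smoothedForm (M : Mesh m ι Ω) (D : Matrix (Fin 3) (Fin 3) ℝ) (u v : M.Vh ΓD) : ℝ :=
  pairing (matMul D (M.P₂ (M.P₁ (M.strainVh u)))) (M.P₂ (M.P₁ (M.strainVh v)))

/-- The strain-smoothed element (SSE) method. -/
def Mesh.IsSSESolution (M : Mesh m ι Ω) (D : Matrix (Fin 3) (Fin 3) ℝ)
    (f : AdmissibleDisp Ω ΓD →L[ℝ] ℝ) (u : M.Vh ΓD) : Prop :=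
  ∀ v : M.Vh ΓD, M.smoothedForm D u v = f (v : AdmissibleDisp Ω ΓD)

end MeshSpaces

end

noncomputable section

/-! Both families of cells partition `Ω` up to null sets, so the smoothing operators are the
orthogonal projections of `StrainL2 Ω` onto the spaces of piecewise constant fields. Since a
constant `D` preserves these spaces, the five-field system can be eliminated exactly: each strain or
stress test field fixes one unknown as a projection. What remains is the equation for `u` with form
`⟪D S u, S v⟫`, where `S = P₂ P₁ B`. This is `fiveField_solvable`; its only nontrivial hypothesis is
that `S` is injective on the discrete displacements, which `eq_zero_of_smoothed_strain_eq_zero`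
proves in two steps.

The first step is `edge_average_eq_zero`: if `P₂ P₁ B v = 0`, then `P₁ B v = 0`. A vertex cell
consists of half of each of two consecutive subtriangles, so the area-weighted edge values alternate
in sign around every element. Around a triangle, an odd cycle, this forces them to vanish. Around a
quadrilateral a checkerboard mode survives. It is excluded globally: its signs agree across shared
edges, so summing sign times area times strain over all subtriangles and grouping by edges gives the
weighted `ℓ¹` norm of a component of the edge values. Grouping by elements gives zero, because the
alternating sum of area-weighted strains in one element vanishes (`crossStrain_alternating_sum`).

The second step is `gradient_eq_zero`: if all edge averages of the strain vanish, then `v = 0`. A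
boundary cell is a single subtriangle, so the strain vanishes there. As the part of the boundary
where `v = 0` has positive length, `v` has two zeros on some boundary edge, and an infinitesimal
rigid motion with two zeros is trivial. Moreover no edge is stretched (`dot_edge_eq_zero`), since
the elongation of an edge is the same seen from both sides. Hence vanishing strain on one
subtriangle and vanishing values at the ends of its edge spread to the whole element
(`vert_eq_zero_of_edge`), then across each edge to its neighbor, and by `edge_connected` to the
whole mesh. -/

theorem pairing_eq_inner {Ω : Set Plane} (σ τ : StrainL2 Ω) : pairing σ τ = inner ℝ σ τ :=
  (L2.inner_def σ τ).symm

/-- The cells of `S` partition `Ω` up to null sets, and have finite area. -/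
structure Subdivision.IsPartition (Ω : Set Plane) (S : Subdivision) : Prop where
  aedisjoint : ∀ T ∈ S.cells, ∀ T' ∈ S.cells, T ≠ T' → AEDisjoint (volume.restrict Ω) T T'
  cover : ∀ᵐ x ∂(volume.restrict Ω), ∃ T ∈ S.cells, x ∈ T
  finite : ∀ T ∈ S.cells, (volume.restrict Ω) T ≠ ⊤

/-! ### Smoothing over a partition as orthogonal projection -/

namespace Subdivision.IsPartition

variable {Ω : Set Plane} {S : Subdivision}

theorem ae_unique (h : S.IsPartition Ω) :
    ∀ᵐ x ∂(volume.restrict Ω), ∀ T ∈ S.cells, ∀ T' ∈ S.cells, x ∈ T → x ∈ T' → T = T' := by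
  refine (ae_ball_iff (Finset.countable_toSet S.cells)).2 fun T hT => ?_
  refine (ae_ball_iff (Finset.countable_toSet S.cells)).2 fun T' hT' => ?_
  by_cases e : T = T'
  · exact Eventually.of_forall fun _ _ _ => e
  · have := h.aedisjoint T hT T' hT' e
    have := measure_eq_zero_iff_ae_notMem.1 this
    exact this.mono fun x hx h1 h2 => (hx ⟨h1, h2⟩).elim

theorem smoothing_ae (h : S.IsPartition Ω) (ε : StrainL2 Ω) :
    ∀ᵐ x ∂(volume.restrict Ω), ∀ T ∈ S.cells, x ∈ T →
      smoothing S ε x = ⨍ y in T, ε y ∂(volume.restrict Ω) := by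
  filter_upwards [h.ae_unique, (memLp_cellMean S ε).coeFn_toLp] with x hx hs T hT hxT
  rw [smoothing, hs, cellMean, Finset.sum_eq_single T, indicator_of_mem hxT]
  · intro T' hT' hne
    exact indicator_of_notMem (fun h' => hne (hx T' hT' T hT h' hxT)) _
  · exact fun h' => (h' hT).elim

theorem smoothing_mem (h : S.IsPartition Ω) (ε : StrainL2 Ω) :
    smoothing S ε ∈ piecewiseConst Ω S := fun T hT =>
  ⟨_, (h.smoothing_ae ε).mono fun _ hx => hx T hT⟩

theorem integral_eq_sum (h : S.IsPartition Ω) {g : Plane → ℝ}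
    (hg : Integrable g (volume.restrict Ω)) :
    ∫ x in Ω, g x = ∑ T ∈ S.cells, ∫ x in T, g x ∂(volume.restrict Ω) := by
  have e : g =ᵐ[volume.restrict Ω] fun x => ∑ T ∈ S.cells, T.indicator g x := by
    filter_upwards [h.ae_unique, h.cover] with x hx ⟨T, hT, hxT⟩
    rw [Finset.sum_eq_single T, indicator_of_mem hxT]
    · intro T' hT' hne
      exact indicator_of_notMem (fun h' => hne (hx T' hT' T hT h' hxT)) _
    · exact fun h' => (h' hT).elim
  rw [integral_congr_ae e, integral_finsetSum _ fun T hT => hg.indicator (S.measurable T hT)]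
  exact Finset.sum_congr rfl fun T hT => integral_indicator (S.measurable T hT)

theorem integrableOn_cell (h : S.IsPartition Ω) (ε : StrainL2 Ω) {T : Set Plane}
    (hT : T ∈ S.cells) : IntegrableOn ε T (volume.restrict Ω) := by
  have : IsFiniteMeasure ((volume.restrict Ω).restrict T) :=
    ⟨by simpa using (h.finite T hT).lt_top⟩
  exact ((Lp.memLp ε).restrict T).integrable (by norm_num)

theorem setIntegral_smoothing (h : S.IsPartition Ω) (ε : StrainL2 Ω) {T : Set Plane}
    (hT : T ∈ S.cells) : ∫ x in T, smoothing S ε x ∂(volume.restrict Ω)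
      = ∫ x in T, ε x ∂(volume.restrict Ω) := by
  have hf := h.finite T hT
  have e : ∫ x in T, smoothing S ε x ∂(volume.restrict Ω)
      = ∫ x in T, (⨍ y in T, ε y ∂(volume.restrict Ω)) ∂(volume.restrict Ω) :=
    setIntegral_congr_ae (S.measurable T hT) ((h.smoothing_ae ε).mono fun x hx => hx T hT)
  have : IsFiniteMeasure ((volume.restrict Ω).restrict T) := ⟨by simpa using hf.lt_top⟩
  rw [e, integral_average]

/-- A piecewise constant field sees only the cell integrals of its partner. Smoothing preserves
these integrals, hence is an orthogonal projection. -/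
theorem inner_eq_sum (h : S.IsPartition Ω) (ε : StrainL2 Ω) {δ : StrainL2 Ω} {c : Set Plane → Voigt}
    (hc : ∀ T ∈ S.cells, ∀ᵐ x ∂(volume.restrict Ω), x ∈ T → δ x = c T) :
    inner ℝ ε δ = ∑ T ∈ S.cells, inner ℝ (∫ x in T, ε x ∂(volume.restrict Ω)) (c T) := by
  rw [L2.inner_def, h.integral_eq_sum (L2.integrable_inner ε δ)]
  refine Finset.sum_congr rfl fun T hT => ?_
  rw [setIntegral_congr_ae (g := fun x => inner ℝ (ε x) (c T)) (S.measurable T hT)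
    ((hc T hT).mono fun x hx hxT => by rw [hx hxT])]
  simp_rw [real_inner_comm (c T)]
  exact integral_inner (h.integrableOn_cell ε hT) (c T)

theorem inner_smoothing (h : S.IsPartition Ω) (ε : StrainL2 Ω) {δ : StrainL2 Ω}
    (hδ : δ ∈ piecewiseConst Ω S) : inner ℝ (smoothing S ε) δ = inner ℝ ε δ := by
  choose! c hc using hδ
  rw [h.inner_eq_sum _ hc, h.inner_eq_sum _ hc]
  exact Finset.sum_congr rfl fun T hT => by rw [h.setIntegral_smoothing ε hT]

/-- The difference of `a` and the smoothed field lies in the piecewise constant space and is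
orthogonal to it. This characterization yields linearity of smoothing. -/
theorem smoothing_eq_iff (h : S.IsPartition Ω) {ε a : StrainL2 Ω} (ha : a ∈ piecewiseConst Ω S)
    (hε : ∀ δ ∈ piecewiseConst Ω S, inner ℝ a δ = inner ℝ ε δ) : a = smoothing S ε := by
  have hm := (piecewiseConst Ω S).sub_mem ha (h.smoothing_mem ε)
  rw [← sub_eq_zero, ← inner_self_eq_zero (𝕜 := ℝ), inner_sub_left, h.inner_smoothing ε hm, hε _ hm,
    sub_self]

/-- The smoothing operator as a linear map. -/
def smoothingₗ (h : S.IsPartition Ω) : StrainL2 Ω →ₗ[ℝ] StrainL2 Ω where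
  toFun := smoothing S
  map_add' ε ε' := (h.smoothing_eq_iff (Submodule.add_mem _ (h.smoothing_mem ε) (h.smoothing_mem ε'))
    fun δ hδ => by
      rw [inner_add_left, inner_add_left, h.inner_smoothing _ hδ, h.inner_smoothing _ hδ]).symm
  map_smul' c ε := (h.smoothing_eq_iff (Submodule.smul_mem _ c (h.smoothing_mem ε))
    fun δ hδ => by
      rw [real_inner_smul_left, real_inner_smul_left, h.inner_smoothing _ hδ]).symm

/-- The cell integrals embed the space in a finite power of `Voigt`: if they all vanish,
`inner_eq_sum` makes the field orthogonal to itself. Working with integrals rather than cell values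
avoids any assumption that cells have positive measure. -/
theorem finite_piecewiseConst (h : S.IsPartition Ω) : Module.Finite ℝ (piecewiseConst Ω S) := by
  let L : piecewiseConst Ω S →ₗ[ℝ] (S.cells → Voigt) :=
    { toFun := fun ε T => ∫ x in T, (ε : StrainL2 Ω) x ∂(volume.restrict Ω)
      map_add' := fun ε ε' => by
        funext T
        rw [Pi.add_apply, ← integral_add (h.integrableOn_cell _ T.2) (h.integrableOn_cell _ T.2)]
        exact integral_congr_ae (ae_restrict_of_ae (Lp.coeFn_add (ε : StrainL2 Ω) ε'))
      map_smul' := fun a ε => by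
        funext T
        rw [Pi.smul_apply, RingHom.id_apply, ← integral_smul]
        exact integral_congr_ae (ae_restrict_of_ae (Lp.coeFn_smul a (ε : StrainL2 Ω))) }
  refine Module.Finite.of_injective L ((injective_iff_map_eq_zero L).2 fun ε hε => ?_)
  have hε' : ∀ T ∈ S.cells, ∫ x in T, (ε : StrainL2 Ω) x ∂(volume.restrict Ω) = 0 :=
    fun T hT => congrFun hε ⟨T, hT⟩
  have hδ := ε.2
  choose! c hc using hδ
  rw [← Submodule.coe_eq_zero, ← inner_self_eq_zero (𝕜 := ℝ), h.inner_eq_sum _ hc]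
  exact Finset.sum_eq_zero fun T hT => by rw [hε' T hT, inner_zero_left]

end Subdivision.IsPartition

/-! ### Abstract elimination of the strains and stresses -/

section FiveField

variable {H V : Type*} [NormedAddCommGroup H] [InnerProductSpace ℝ H] [AddCommMonoid V]
  [Module ℝ V]

/-- Unique solvability of a coercive variational problem in finite dimension. -/
theorem exists_unique_variational [Module.Finite ℝ V] (a : V →ₗ[ℝ] V →ₗ[ℝ] ℝ)
    (ha : ∀ v, a v v = 0 → v = 0) (F : V →ₗ[ℝ] ℝ) : ∃ u, a u = F ∧ ∀ w, a w = F → w = u := by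
  let _ : AddCommGroup V := Module.addCommMonoidToAddCommGroup ℝ
  have hinj : Function.Injective a :=
    (injective_iff_map_eq_zero a).2 fun v hv => ha v (by rw [hv, LinearMap.zero_apply])
  -- An injective map from `V` to its dual is onto, the dimensions being equal.
  have hsurj : Function.Surjective a :=
    (LinearMap.injective_iff_surjective_of_finrank_eq_finrank
      (Subspace.dual_finrank_eq (K := ℝ) (V := V)).symm).1 hinj
  obtain ⟨u, hu⟩ := hsurj F
  exact ⟨u, hu, fun w hw => hinj (hw.trans hu.symm)⟩

/-- The five-field principle on subspaces onto which `P₁`, `P₂` are the orthogonal projections. -/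
theorem fiveField_solvable {K₁ K₂ : Submodule ℝ H} [FiniteDimensional ℝ K₂]
    {P₁ P₂ D : H →ₗ[ℝ] H} {B : V →ₗ[ℝ] H} (F : V →ₗ[ℝ] ℝ)
    (hP₁ : ∀ ε, P₁ ε ∈ K₁) (hP₂ : ∀ ε, P₂ ε ∈ K₂)
    (hi₁ : ∀ ε, ∀ δ ∈ K₁, inner ℝ (P₁ ε) δ = inner ℝ ε δ)
    (hi₂ : ∀ ε, ∀ δ ∈ K₂, inner ℝ (P₂ ε) δ = inner ℝ ε δ)
    (hD : ∀ ε ∈ K₂, D ε ∈ K₂) (hDpos : ∀ ε, inner ℝ (D ε) ε = 0 → ε = 0)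
    (hB : ∀ v, P₂ (P₁ (B v)) = 0 → v = 0) :
    ∃ (u : V) (ε₁ : K₁) (ε₂ : K₂) (σ₁ : K₁) (σ₂ : K₂),
      ((∀ (v : V) (δ₁ : K₁) (δ₂ : K₂),
          inner ℝ (σ₁ : H) (B v) + inner ℝ (-(σ₁ : H) + σ₂) (δ₁ : H)
            + inner ℝ (D ε₂ - σ₂) (δ₂ : H) = F v) ∧
        ∀ (τ₁ : K₁) (τ₂ : K₂),
          inner ℝ (τ₁ : H) (B u - ε₁) + inner ℝ (τ₂ : H) ((ε₁ : H) - ε₂) = 0) ∧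
      (∀ (u' : V) (ε₁' : K₁) (ε₂' : K₂) (σ₁' : K₁) (σ₂' : K₂),
        ((∀ (v : V) (δ₁ : K₁) (δ₂ : K₂),
          inner ℝ (σ₁' : H) (B v) + inner ℝ (-(σ₁' : H) + σ₂') (δ₁ : H)
            + inner ℝ (D ε₂' - σ₂') (δ₂ : H) = F v) ∧
        ∀ (τ₁ : K₁) (τ₂ : K₂),
          inner ℝ (τ₁ : H) (B u' - ε₁') + inner ℝ (τ₂ : H) ((ε₁' : H) - ε₂') = 0) →
          u' = u ∧ ε₁' = ε₁ ∧ ε₂' = ε₂ ∧ σ₁' = σ₁ ∧ σ₂' = σ₂) ∧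
      (ε₁ : H) = P₁ (B u) ∧ (ε₂ : H) = P₂ (P₁ (B u)) ∧
      (σ₁ : H) = P₁ (P₂ (D (P₂ (P₁ (B u))))) ∧ (σ₂ : H) = D (P₂ (P₁ (B u))) ∧
      (∀ v, inner ℝ (D (P₂ (P₁ (B u)))) (P₂ (P₁ (B v))) = F v) ∧
      ∀ w, (∀ v, inner ℝ (D (P₂ (P₁ (B w)))) (P₂ (P₁ (B v))) = F v) → w = u := by
  let _ : AddCommGroup V := Module.addCommMonoidToAddCommGroup ℝ
  have eq₁ : ∀ ε, ∀ a ∈ K₁, (∀ δ ∈ K₁, inner ℝ a δ = inner ℝ ε δ) → a = P₁ ε := by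
    intro ε a ha h
    have hm := K₁.sub_mem ha (hP₁ ε)
    rw [← sub_eq_zero, ← inner_self_eq_zero (𝕜 := ℝ), inner_sub_left, hi₁ _ _ hm, h _ hm, sub_self]
  have eq₂ : ∀ ε, ∀ a ∈ K₂, (∀ δ ∈ K₂, inner ℝ a δ = inner ℝ ε δ) → a = P₂ ε := by
    intro ε a ha h
    have hm := K₂.sub_mem ha (hP₂ ε)
    rw [← sub_eq_zero, ← inner_self_eq_zero (𝕜 := ℝ), inner_sub_left, hi₂ _ _ hm, h _ hm, sub_self]
  let S : V →ₗ[ℝ] H := P₂ ∘ₗ P₁ ∘ₗ B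
  have hS : ∀ v, S v = P₂ (P₁ (B v)) := fun _ => rfl
  -- `S` embeds `V` in the finite-dimensional `K₂`, so no basis of the finite element space is
  -- needed.
  have hfin : Module.Finite ℝ V := by
    refine Module.Finite.of_injective (S.codRestrict K₂ fun v => hP₂ _)
      ((injective_iff_map_eq_zero _).2 fun v hv => hB v ?_)
    exact congrArg Subtype.val hv
  let a : V →ₗ[ℝ] V →ₗ[ℝ] ℝ := ((innerₗ H).comp (D ∘ₗ S)).compl₂ S
  have ha : ∀ u v, a u v = inner ℝ (D (P₂ (P₁ (B u)))) (P₂ (P₁ (B v))) := fun _ _ => rfl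
  obtain ⟨u, hu, huniq⟩ := exists_unique_variational a
    (fun v hv => hB v (hDpos _ ((ha v v).symm.trans hv))) F
  -- Self-adjointness of the projections: `⟪P₁ σ, B v⟫ = ⟪σ, P₁ B v⟫`, and `σ ∈ K₂` permits
  -- inserting `P₂` on the right.
  have key : ∀ σ ∈ K₂, ∀ v, inner ℝ (P₁ σ) (B v) = inner ℝ σ (P₂ (P₁ (B v))) := by
    intro σ hσ v
    rw [real_inner_comm, ← hi₁ _ _ (hP₁ σ), real_inner_comm, hi₁ _ _ (hP₁ _), real_inner_comm,
      ← hi₂ _ _ hσ, real_inner_comm]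
  have sse : ∀ w, (∀ v, inner ℝ (D (P₂ (P₁ (B w)))) (P₂ (P₁ (B v))) = F v) → w = u :=
    fun w hw => huniq w (LinearMap.ext hw)
  have hσ := hD _ (hP₂ (P₁ (B u)))
  -- `D` maps `K₂` into itself, so the outer `P₂` in the formula for `σ₁` acts as the identity.
  have hPσ : P₂ (D (P₂ (P₁ (B u)))) = D (P₂ (P₁ (B u))) := (eq₂ _ _ hσ fun _ _ => rfl).symm
  refine ⟨u, ⟨_, hP₁ (B u)⟩, ⟨_, hP₂ (P₁ (B u))⟩, ⟨_, hP₁ (P₂ (D (P₂ (P₁ (B u)))))⟩, ⟨_, hσ⟩,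
    ⟨fun v δ₁ δ₂ => ?_, fun τ₁ τ₂ => ?_⟩, ?_, rfl, rfl, rfl, rfl,
    fun v => LinearMap.congr_fun hu v, sse⟩
  · simp only [hPσ, sub_self, inner_zero_left, add_zero]
    rw [inner_add_left, inner_neg_left, hi₁ _ _ δ₁.2, neg_add_cancel, add_zero, key _ hσ]
    exact LinearMap.congr_fun hu v
  · rw [inner_sub_right, inner_sub_right, real_inner_comm (P₁ (B u)), hi₁ _ _ τ₁.2,
      real_inner_comm (P₂ _), hi₂ _ _ τ₂.2, real_inner_comm, real_inner_comm (τ₂ : H), sub_self,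
      sub_self, add_zero]
  -- Setting all test fields but one to zero isolates one equation: `τ₁` gives `ε₁`, `τ₂` gives
  -- `ε₂`, `δ₂` gives `σ₂`, `δ₁` gives `σ₁`, and `v` leaves the reduced problem for `u'`.
  · rintro u' ε₁' ε₂' σ₁' σ₂' ⟨h1, h2⟩
    have e1 : (ε₁' : H) = P₁ (B u') := eq₁ _ _ ε₁'.2 fun δ hδ => by
      have := h2 ⟨δ, hδ⟩ 0
      rw [Submodule.coe_zero, inner_zero_left, add_zero, inner_sub_right] at this
      rw [real_inner_comm, real_inner_comm δ]
      exact (sub_eq_zero.1 this).symm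
    have e2 : (ε₂' : H) = P₂ (P₁ (B u')) := eq₂ _ _ ε₂'.2 fun δ hδ => by
      have := h2 0 ⟨δ, hδ⟩
      rw [Submodule.coe_zero, inner_zero_left, zero_add, inner_sub_right] at this
      rw [← e1, real_inner_comm, real_inner_comm δ]
      exact (sub_eq_zero.1 this).symm
    have e3 : D (ε₂' : H) - σ₂' = 0 := by
      rw [← inner_self_eq_zero (𝕜 := ℝ)]
      -- The residual itself is an admissible test field because `D` preserves `K₂`.
      have := h1 0 0 ⟨_, K₂.sub_mem (hD _ ε₂'.2) σ₂'.2⟩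
      simpa using this
    have e4 : (σ₂' : H) = D (P₂ (P₁ (B u'))) := by rw [← e2, ← sub_eq_zero.1 e3]
    have e5 : (σ₁' : H) = P₁ σ₂' := eq₁ _ _ σ₁'.2 fun δ hδ => by
      have := h1 0 ⟨δ, hδ⟩ 0
      rw [map_zero, inner_zero_right, zero_add, Submodule.coe_zero, inner_zero_right, add_zero,
        map_zero, inner_add_left, inner_neg_left] at this
      linarith
    have hu' : u' = u := sse u' fun v => by
      have := h1 v 0 0
      rw [Submodule.coe_zero, inner_zero_right, add_zero, Submodule.coe_zero, inner_zero_right,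
        add_zero, e5, key _ σ₂'.2] at this
      rwa [← e4]
    subst hu'
    refine ⟨rfl, Subtype.ext e1, Subtype.ext e2, Subtype.ext ?_, Subtype.ext e4⟩
    rw [e5, e4, hPσ]

end FiveField

/-! ### Plane geometry -/

theorem cross_add_left (a b c : Plane) : cross (a + b) c = cross a c + cross b c := by
  simp only [cross, PiLp.add_apply]; ring

theorem cross_add_right (a b c : Plane) : cross a (b + c) = cross a b + cross a c := by
  simp only [cross, PiLp.add_apply]; ring

theorem cross_smul_left (r : ℝ) (a b : Plane) : cross (r • a) b = r * cross a b := by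
  simp only [cross, PiLp.smul_apply, smul_eq_mul]; ring

theorem cross_smul_right (r : ℝ) (a b : Plane) : cross a (r • b) = r * cross a b := by
  simp only [cross, PiLp.smul_apply, smul_eq_mul]; ring

theorem cross_neg_left (a b : Plane) : cross (-a) b = -cross a b := by
  simp only [cross, PiLp.neg_apply]; ring

theorem cross_neg_right (a b : Plane) : cross a (-b) = -cross a b := by
  simp only [cross, PiLp.neg_apply]; ring

theorem cross_same (a : Plane) : cross a a = 0 := by
  simp only [cross]; ring

theorem cross_swap (a b : Plane) : cross b a = -cross a b := by
  simp only [cross]; ring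

theorem cross_sum_right {α : Type*} (s : Finset α) (a : Plane) (f : α → Plane) :
    cross a (∑ k ∈ s, f k) = ∑ k ∈ s, cross a (f k) := by
  classical
  induction s using Finset.induction_on with
  | empty => simp [cross]
  | insert k s hk ih => rw [Finset.sum_insert hk, Finset.sum_insert hk, cross_add_right, ih]

theorem cross_sum_left {α : Type*} (s : Finset α) (a : Plane) (f : α → Plane) :
    cross (∑ k ∈ s, f k) a = ∑ k ∈ s, cross (f k) a := by
  simp only [fun b => cross_swap a b, cross_sum_right, Finset.sum_neg_distrib]

/-- Cramer's rule. -/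
theorem cross_smul_eq (P Q z : Plane) : cross P Q • z = cross z Q • P + cross P z • Q := by
  ext k
  fin_cases k <;> simp [cross] <;> ring

theorem eq_smul_add_smul {P Q : Plane} (h : cross P Q ≠ 0) (z : Plane) :
    z = (cross z Q / cross P Q) • P + (cross P z / cross P Q) • Q := by
  have := congrArg (fun y => (cross P Q)⁻¹ • y) (cross_smul_eq P Q z)
  simp only [smul_smul, smul_add, inv_mul_cancel₀ h, one_smul] at this
  rw [div_eq_inv_mul, div_eq_inv_mul]
  exact this

/-- Coordinates are taken relative to `c` because later `c` is the center shared by all subtriangles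
of an element. -/
theorem mem_triangle {a b c y : Plane} : y ∈ convexHull ℝ {c, a, b} ↔
    ∃ α β : ℝ, 0 ≤ α ∧ 0 ≤ β ∧ α + β ≤ 1 ∧ y = c + (α • (a - c) + β • (b - c)) := by
  constructor
  · intro hy
    refine convexHull_min (t := {y | ∃ α β : ℝ, 0 ≤ α ∧ 0 ≤ β ∧ α + β ≤ 1 ∧
      y = c + (α • (a - c) + β • (b - c))}) ?_ ?_ hy
    · rintro x (rfl | rfl | rfl)
      · exact ⟨0, 0, le_rfl, le_rfl, by norm_num, by simp⟩
      · exact ⟨1, 0, by norm_num, le_rfl, by norm_num, by simp⟩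
      · exact ⟨0, 1, le_rfl, by norm_num, by norm_num, by simp⟩
    · rintro _ ⟨α, β, h1, h2, h3, rfl⟩ _ ⟨α', β', k1, k2, k3, rfl⟩ s t hs ht hst
      refine ⟨s * α + t * α', s * β + t * β', by positivity, by positivity, ?_, ?_⟩
      · nlinarith
      · obtain rfl : t = 1 - s := by linarith
        module
  · rintro ⟨α, β, h1, h2, h3, rfl⟩
    have hc : c ∈ convexHull ℝ {c, a, b} := subset_convexHull ℝ _ (by simp)
    have ha : a ∈ convexHull ℝ {c, a, b} := subset_convexHull ℝ _ (by simp)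
    have hb : b ∈ convexHull ℝ {c, a, b} := subset_convexHull ℝ _ (by simp)
    have := (convex_convexHull ℝ {c, a, b}).sum_mem (t := Finset.univ)
      (w := ![1 - α - β, α, β]) (z := ![c, a, b])
      (by intro i _; fin_cases i <;> simp <;> linarith)
      (by simp [Fin.sum_univ_three]; ring) (by intro i _; fin_cases i <;> simpa)
    convert this using 1
    simp [Fin.sum_univ_three]
    module

/-- A point in the closed sector of two edges of a triangle that lies on the inner side of the
third edge belongs to the triangle. -/
theorem mem_triangle_of_cross {a b c y : Plane} (h : 0 < cross (a - c) (b - c))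
    (h1 : 0 ≤ cross (a - c) (y - c)) (h2 : 0 ≤ cross (y - c) (b - c))
    (h3 : 0 ≤ cross (b - a) (y - a)) : y ∈ convexHull ℝ {c, a, b} := by
  refine mem_triangle.2 ⟨_, _, div_nonneg h2 h.le, div_nonneg h1 h.le, ?_, ?_⟩
  · rw [← add_div, div_le_one h]
    have e : cross (b - a) (y - a) = cross (a - c) (b - c)
        - (cross (y - c) (b - c) + cross (a - c) (y - c)) := by
      simp only [cross, PiLp.sub_apply]; ring
    linarith
  · rw [← eq_smul_add_smul h.ne']
    abel

theorem cross_nonneg_of_mem_triangle {a b c y : Plane} (h : 0 < cross (a - c) (b - c))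
    (hy : y ∈ convexHull ℝ {c, a, b}) :
    0 ≤ cross (a - c) (y - c) ∧ 0 ≤ cross (y - c) (b - c) ∧ 0 ≤ cross (b - a) (y - a) := by
  obtain ⟨α, β, h1, h2, h3, rfl⟩ := mem_triangle.1 hy
  have e : c + (α • (a - c) + β • (b - c)) - c = α • (a - c) + β • (b - c) := by abel
  have e' : cross (b - a) (c + (α • (a - c) + β • (b - c)) - a)
      = (1 - α - β) * cross (a - c) (b - c) := by
    simp only [cross, PiLp.sub_apply, PiLp.add_apply, PiLp.smul_apply, smul_eq_mul]; ring
  rw [e, e', cross_add_right, cross_add_left, cross_smul_right, cross_smul_right,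
    cross_smul_left, cross_smul_left, cross_same, cross_same]
  exact ⟨by simpa using mul_nonneg h2 h.le, by simpa using mul_nonneg h1 h.le,
    mul_nonneg (by linarith) h.le⟩

theorem volume_line {u : Plane} (hu : u ≠ 0) (c : Plane) :
    volume {y : Plane | cross u (y - c) = 0} = 0 := by
  let L : Plane →ₗ[ℝ] ℝ :=
    { toFun := cross u, map_add' := cross_add_right u,
      map_smul' := fun r a => by simp [cross_smul_right] }
  have hL : LinearMap.ker L ≠ ⊤ := by
    intro h
    apply hu
    have h0 : ∀ y, cross u y = 0 := fun y => (LinearMap.mem_ker (f := L)).1 (h ▸ Submodule.mem_top)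
    have h1 := h0 (EuclideanSpace.single 0 1)
    have h2 := h0 (EuclideanSpace.single 1 1)
    simp [cross] at h1 h2
    ext k
    fin_cases k <;> simpa
  have := Measure.addHaar_submodule (volume : Measure Plane) _ hL
  have e : {y : Plane | cross u (y - c) = 0} = (fun y => y - c) ⁻¹' (LinearMap.ker L : Set Plane) :=
    rfl
  rw [e]
  simp only [sub_eq_add_neg]
  rw [measure_preimage_add_right, this]

theorem volume_segment (a b : Plane) (h : a ≠ b) : volume (segment ℝ a b) = 0 := by
  refine measure_mono_null ?_ (volume_line (sub_ne_zero.2 h.symm) a)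
  intro y hy
  rw [segment_eq_image'] at hy
  obtain ⟨t, -, rfl⟩ := hy
  simp [cross_smul_right, cross_same]

theorem right_ne_zero_of_cross_ne {a b : Plane} (h : cross a b ≠ 0) : b ≠ 0 := by
  rintro rfl
  exact h (by simp [cross])

/-- The standard triangle. -/
def stdTriangle : Set Plane :=
  convexHull ℝ {0, EuclideanSpace.single 0 1, EuclideanSpace.single 1 1}

/-- The triangle is a translate of the image of `stdTriangle` under the matrix with columns `a - c`
and `b - c`. The volume of `stdTriangle` is never evaluated; only that it is positive and finite
matters. -/
theorem volume_triangle (a b c : Plane) : volume (convexHull ℝ {c, a, b})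
    = ENNReal.ofReal |cross (a - c) (b - c)| * volume stdTriangle := by
  let N : Matrix (Fin 2) (Fin 2) ℝ := !![(a - c) 0, (b - c) 0; (a - c) 1, (b - c) 1]
  let L : Plane →ₗ[ℝ] Plane := Matrix.toLpLin 2 2 N
  have hdet : LinearMap.det L = cross (a - c) (b - c) := by
    rw [LinearMap.det_toLpLin, Matrix.det_fin_two_of, cross]; ring
  have h0 : L (EuclideanSpace.single 0 1) = a - c := by
    ext k; fin_cases k <;> simp [L, N, Matrix.toLpLin_apply]
  have h1 : L (EuclideanSpace.single 1 1) = b - c := by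
    ext k; fin_cases k <;> simp [L, N, Matrix.toLpLin_apply]
  have e : convexHull ℝ {c, a, b} = (fun y => y + -c) ⁻¹' (L '' stdTriangle) := by
    ext y
    rw [mem_triangle, mem_preimage]
    constructor
    · rintro ⟨α, β, h1', h2', h3', rfl⟩
      refine ⟨_, mem_triangle.2 ⟨α, β, h1', h2', h3', rfl⟩, ?_⟩
      simp only [zero_add, sub_zero, map_add, map_smul, h0, h1]
      abel
    · rintro ⟨x, hx, hy⟩
      obtain ⟨α, β, h1', h2', h3', rfl⟩ := mem_triangle.1 hx
      refine ⟨α, β, h1', h2', h3', ?_⟩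
      simp only [zero_add, sub_zero, map_add, map_smul, h0, h1] at hy
      rw [hy]; abel
  rw [e, measure_preimage_add_right, Measure.addHaar_image_linearMap, hdet]

theorem volume_stdTriangle_ne_top : volume stdTriangle ≠ ⊤ :=
  ((toFinite _).isCompact_convexHull (𝕜 := ℝ)).measure_lt_top.ne

theorem interior_triangle_nonempty {a b c : Plane} (h : 0 < cross (a - c) (b - c)) :
    (interior (convexHull ℝ {c, a, b})).Nonempty := by
  let O : Set Plane := {y | 0 < cross (a - c) (y - c) ∧ 0 < cross (y - c) (b - c) ∧
    0 < cross (b - a) (y - a)}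
  have hO : IsOpen O := by
    have h1 : Continuous fun y : Plane => cross (a - c) (y - c) := by unfold cross; fun_prop
    have h2 : Continuous fun y : Plane => cross (y - c) (b - c) := by unfold cross; fun_prop
    have h3 : Continuous fun y : Plane => cross (b - a) (y - a) := by unfold cross; fun_prop
    exact (isOpen_lt continuous_const h1).inter
      ((isOpen_lt continuous_const h2).inter (isOpen_lt continuous_const h3))
  refine ⟨c + ((1 / 3 : ℝ) • (a - c) + (1 / 3 : ℝ) • (b - c)), mem_interior.2 ⟨O, fun y hy =>
    mem_triangle_of_cross h hy.1.le hy.2.1.le hy.2.2.le, hO, ?_, ?_, ?_⟩⟩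
  · have : c + ((1 / 3 : ℝ) • (a - c) + (1 / 3 : ℝ) • (b - c)) - c
      = (1 / 3 : ℝ) • (a - c) + (1 / 3 : ℝ) • (b - c) := by abel
    rw [this, cross_add_right, cross_smul_right, cross_smul_right, cross_same]
    linarith
  · have : c + ((1 / 3 : ℝ) • (a - c) + (1 / 3 : ℝ) • (b - c)) - c
      = (1 / 3 : ℝ) • (a - c) + (1 / 3 : ℝ) • (b - c) := by abel
    rw [this, cross_add_left, cross_smul_left, cross_smul_left, cross_same]
    linarith
  · have e : cross (b - a) (c + ((1 / 3 : ℝ) • (a - c) + (1 / 3 : ℝ) • (b - c)) - a)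
        = cross (a - c) (b - c) / 3 := by
      simp only [cross, PiLp.sub_apply, PiLp.add_apply, PiLp.smul_apply, smul_eq_mul]; ring
    rw [e]; linarith

theorem volume_stdTriangle_ne_zero : volume stdTriangle ≠ 0 := by
  have : (interior stdTriangle).Nonempty := interior_triangle_nonempty (by simp [cross])
  exact ((isOpen_interior.measure_pos volume this).trans_le (measure_mono interior_subset)).ne'

/-- Splitting a triangle by a median. -/
theorem triangle_eq_union_midpoint (a b c : Plane) : convexHull ℝ {c, a, b} =
    convexHull ℝ {c, a, midpoint ℝ a b} ∪ convexHull ℝ {c, midpoint ℝ a b, b} := by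
  have hm : midpoint ℝ a b - c = (1 / 2 : ℝ) • (a - c) + (1 / 2 : ℝ) • (b - c) := by
    rw [midpoint_eq_smul_add]; norm_num; module
  have hm' : midpoint ℝ a b ∈ convexHull ℝ {c, a, b} :=
    mem_triangle.2 ⟨1 / 2, 1 / 2, by norm_num, by norm_num, by norm_num, by rw [← hm]; abel⟩
  apply Subset.antisymm
  · intro y hy
    obtain ⟨α, β, h1, h2, h3, rfl⟩ := mem_triangle.1 hy
    -- The median is the ray `α = β`; on either side of it the smaller coordinate is absorbed by the
    -- midpoint.
    rcases le_total β α with h | h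
    · exact Or.inl (mem_triangle.2 ⟨α - β, 2 * β, by linarith, by linarith, by linarith, by
        rw [hm]; module⟩)
    · exact Or.inr (mem_triangle.2 ⟨2 * α, β - α, by linarith, by linarith, by linarith, by
        rw [hm]; module⟩)
  · apply union_subset <;> refine convexHull_min ?_ (convex_convexHull ℝ _) <;>
    · rintro x (rfl | rfl | rfl)
      all_goals first | exact hm' | exact subset_convexHull ℝ _ (by simp)

/-- Splitting a convex quadrilateral by a diagonal. -/
theorem quadrilateral_eq_union {a b c x : Plane} (h1 : 0 < cross (a - c) (x - c))
    (h2 : 0 < cross (x - c) (b - c)) (h3 : 0 ≤ cross (a - c) (b - c))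
    (h4 : 0 ≤ cross (x - a) (b - x)) : convexHull ℝ {c, a, x, b} =
    convexHull ℝ {c, a, x} ∪ convexHull ℝ {c, x, b} := by
  apply Subset.antisymm
  · intro y hy
    have hy' : ∃ α β γ : ℝ, 0 ≤ α ∧ 0 ≤ β ∧ 0 ≤ γ ∧ α + β + γ ≤ 1 ∧
        y = c + (α • (a - c) + β • (x - c) + γ • (b - c)) := by
      refine convexHull_min (t := {y | ∃ α β γ : ℝ, 0 ≤ α ∧ 0 ≤ β ∧ 0 ≤ γ ∧ α + β + γ ≤ 1 ∧
        y = c + (α • (a - c) + β • (x - c) + γ • (b - c))}) ?_ ?_ hy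
      · rintro z (rfl | rfl | rfl | rfl)
        · exact ⟨0, 0, 0, le_rfl, le_rfl, le_rfl, by norm_num, by simp⟩
        · exact ⟨1, 0, 0, by norm_num, le_rfl, le_rfl, by norm_num, by simp⟩
        · exact ⟨0, 1, 0, le_rfl, by norm_num, le_rfl, by norm_num, by simp⟩
        · exact ⟨0, 0, 1, le_rfl, le_rfl, by norm_num, by norm_num, by simp⟩
      · rintro _ ⟨α, β, γ, h1, h2, h3, h4, rfl⟩ _ ⟨α', β', γ', k1, k2, k3, k4, rfl⟩ s t hs ht hst
        refine ⟨s * α + t * α', s * β + t * β', s * γ + t * γ', by positivity, by positivity,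
          by positivity, ?_, ?_⟩
        · nlinarith
        · obtain rfl : t = 1 - s := by linarith
          module
    obtain ⟨α, β, γ, ha, hb, hg, hs, rfl⟩ := hy'
    set P := a - c with hP
    set X := x - c with hX
    set R := b - c with hR
    have e4 : cross (x - a) (b - x) = cross X R - cross P R + cross P X := by
      have e1 : x - a = X - P := by rw [hX, hP]; abel
      have e2 : b - x = R - X := by rw [hX, hR]; abel
      rw [e1, e2]; simp only [cross, PiLp.sub_apply]; ring
    rw [e4] at h4
    have hrel : cross P R • X = cross X R • P + cross P X • R := cross_smul_eq P R X
    set u := cross X R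
    set v := cross P X
    set d := cross P R
    -- Subtracting a multiple of the relation `u • P + v • R = d • X` removes whichever of the
    -- coefficients of `P` and `R` reaches zero first. The coefficient sum does not grow because `u
    -- - d + v ≥ 0`, which is convexity at `x`.
    rcases le_total (α / u) (γ / v) with h | h
    · refine Or.inr (mem_triangle.2 ⟨β + α / u * d, γ - α / u * v, by positivity, ?_, ?_, ?_⟩)
      · have := (le_div_iff₀ h1).1 h; linarith
      · have e : α / u * u = α := div_mul_cancel₀ _ h2.ne'
        have : 0 ≤ α / u * (u - d + v) := by positivity
        nlinarith
      · have e : α / u * u = α := div_mul_cancel₀ _ h2.ne'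
        have e' : α • P = (α / u * d) • X - (α / u * v) • R := by
          rw [mul_smul, mul_smul, hrel, smul_add, smul_smul, smul_smul, e]; abel
        rw [e']; module
    · refine Or.inl (mem_triangle.2 ⟨α - γ / v * u, β + γ / v * d, ?_, by positivity, ?_, ?_⟩)
      · have := (le_div_iff₀ h2).1 h; linarith
      · have e : γ / v * v = γ := div_mul_cancel₀ _ h1.ne'
        have : 0 ≤ γ / v * (u - d + v) := by positivity
        nlinarith
      · have e : γ / v * v = γ := div_mul_cancel₀ _ h1.ne'
        have e' : γ • R = (γ / v * d) • X - (γ / v * u) • P := by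
          rw [mul_smul, mul_smul, hrel, smul_add, smul_smul, smul_smul, e]; abel
        rw [e']; module
  · apply union_subset <;> refine convexHull_mono ?_ <;> intro z hz <;> simp at hz ⊢ <;> tauto

/-! ### Geometry of one element -/

theorem Fin.sum_three_cyclic [NeZero 3] {F : Type*} [AddCommMonoid F] (f : Fin 3 → F) (j : Fin 3) :
    ∑ k, f k = f j + f (j + 1) + f (j + 2) := by
  rw [Fin.sum_univ_three]
  fin_cases j
  · rfl
  · change _ = f 1 + f 2 + f 0
    abel
  · change _ = f 2 + f 0 + f 1
    abel

theorem Fin.sum_four_cyclic [NeZero 4] {F : Type*} [AddCommMonoid F] (f : Fin 4 → F) (j : Fin 4) :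
    ∑ k, f k = f j + f (j + 1) + f (j + 2) + f (j + 3) := by
  rw [Fin.sum_univ_four]
  fin_cases j
  · rfl
  · change _ = f 1 + f 2 + f 3 + f 0
    abel
  · change _ = f 2 + f 3 + f 0 + f 1
    abel
  · change _ = f 3 + f 0 + f 1 + f 2
    abel

theorem Fin.three_cases [NeZero 3] (j k : Fin 3) : k = j ∨ k = j + 1 ∨ k = j + 2 := by
  fin_cases j <;> fin_cases k <;> simp

theorem Fin.four_cases [NeZero 4] (j k : Fin 4) : k = j ∨ k = j + 1 ∨ k = j + 2 ∨ k = j + 3 := by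
  fin_cases j <;> fin_cases k <;> simp

theorem Fin.add_one_add_one {m : ℕ} [NeZero m] (j : Fin m) : j + 1 + 1 = j + 2 := by
  open Fin.CommRing in
  rw [add_assoc, one_add_one_eq_two]

theorem Fin.add_two_add_one {m : ℕ} [NeZero m] (j : Fin m) : j + 2 + 1 = j + 3 := by
  open Fin.CommRing in
  rw [add_assoc, two_add_one_eq_three]

theorem Fin.add_three_three [NeZero 3] (j : Fin 3) : j + 3 = j := by
  fin_cases j <;> rfl

theorem Fin.add_three_add_one_four [NeZero 4] (j : Fin 4) : j + 3 + 1 = j := by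
  fin_cases j <;> rfl

theorem Fin.ne_cases {m : ℕ} [NeZero m] (hm : m = 3 ∨ m = 4) {j k : Fin m} (h : j ≠ k) :
    k = j + 1 ∨ j = k + 1 ∨ (m = 4 ∧ k = j + 2) := by
  rcases hm with rfl | rfl
  · rcases Fin.three_cases j k with rfl | rfl | rfl
    · exact (h rfl).elim
    · exact Or.inl rfl
    · exact Or.inr (Or.inl (by rw [Fin.add_two_add_one, Fin.add_three_three]))
  · rcases Fin.four_cases j k with rfl | rfl | rfl | rfl
    · exact (h rfl).elim
    · exact Or.inl rfl
    · exact Or.inr (Or.inr ⟨rfl, rfl⟩)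
    · exact Or.inr (Or.inl (by rw [Fin.add_three_add_one_four]))

/-- In a cyclic sequence with sum zero there is a descent through zero. -/
theorem Fin.exists_nonneg_nonpos {m : ℕ} [NeZero m] (s : Fin m → ℝ) (h : ∑ j, s j = 0) :
    ∃ j, 0 ≤ s j ∧ s (j + 1) ≤ 0 := by
  by_contra! H
  -- Without a descent, a nonnegative term has a positive successor, and this propagates around the
  -- cycle. So all terms are nonnegative or all are negative; neither is compatible with sum zero.
  have hall : (∃ j, 0 ≤ s j) → ∀ j, 0 ≤ s j := by
    rintro ⟨j, hj⟩
    have h1 : ∀ n : ℕ, 0 ≤ s (j + Fin.ofNat m n) := by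
      intro n
      induction n with
      | zero => simpa using hj
      | succ n ih =>
        have e : j + Fin.ofNat m (n + 1) = j + Fin.ofNat m n + 1 := by
          rw [add_assoc]
          congr 1
          ext
          simp [Fin.val_add]
        rw [e]
        exact (H _ ih).le
    intro k
    have := h1 (k - j).val
    have e : Fin.ofNat m (k - j).val = k - j := by ext; simp [Fin.ofNat, Nat.mod_eq_of_lt]
    rwa [e, add_sub_cancel] at this
  by_cases hj : ∃ j, 0 ≤ s j
  · have h0 := (Finset.sum_eq_zero_iff_of_nonneg fun j _ => hall hj j).1 h
    obtain ⟨j, hj'⟩ := hj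
    exact (H j hj').ne' (h0 _ (Finset.mem_univ _))
  · push Not at hj
    exact (Finset.sum_neg (fun j _ => hj j) ⟨0, Finset.mem_univ _⟩).ne h

namespace Mesh

variable {m : ℕ} [NeZero m] {ι : Type} {Ω : Set Plane} (M : Mesh m ι Ω)

/-- The vector from the center of an element to its `j`-th vertex. -/
def arm (i : ι) (j : Fin m) : Plane := M.vert i j - center M.vert i

/-- Twice the area of a subtriangle. -/
def area (p : ι × Fin m) : ℝ := cross (M.arm p.1 p.2) (M.arm p.1 (p.2 + 1))

theorem sum_arm (i : ι) : ∑ j, M.arm i j = 0 := by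
  have h : (m : ℝ) ≠ 0 := Nat.cast_ne_zero.2 (NeZero.ne m)
  simp only [arm, Finset.sum_sub_distrib, Finset.sum_const, Finset.card_univ, Fintype.card_fin]
  rw [_root_.center, ← Nat.cast_smul_eq_nsmul ℝ, smul_smul, mul_inv_cancel₀ h, one_smul, sub_self]

theorem arm_sub (i : ι) (j k : Fin m) : M.arm i j - M.arm i k = M.vert i j - M.vert i k := by
  simp only [arm]; abel

theorem cross_vert_pos (i : ι) (j : Fin m) :
    0 < cross (M.vert i (j + 1) - M.vert i j) (M.vert i (j + 2) - M.vert i j) := by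
  have h := M.convex i j
  have e : cross (M.vert i (j + 1) - M.vert i j) (M.vert i (j + 2) - M.vert i j)
      = cross (M.vert i (j + 1) - M.vert i j) (M.vert i (j + 2) - M.vert i (j + 1)) := by
    simp only [cross, PiLp.sub_apply]; ring
  rwa [e]

/-- The local turning condition becomes global because, with at most four vertices, every further
vertex is adjacent to an endpoint of the edge, and the turn at that endpoint decides its side. -/
theorem cross_vert_nonneg (hm : m = 3 ∨ m = 4) (i : ι) (j k : Fin m) :
    0 ≤ cross (M.vert i (j + 1) - M.vert i j) (M.vert i k - M.vert i j) := by
  have h0 : 0 ≤ cross (M.vert i (j + 1) - M.vert i j) (M.vert i j - M.vert i j) := by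
    simp [cross]
  have h1 : 0 ≤ cross (M.vert i (j + 1) - M.vert i j) (M.vert i (j + 1) - M.vert i j) :=
    (cross_same _).ge
  rcases hm with rfl | rfl
  · rcases Fin.three_cases j k with rfl | rfl | rfl
    exacts [h0, h1, (M.cross_vert_pos i j).le]
  · rcases Fin.four_cases j k with rfl | rfl | rfl | rfl
    · exact h0
    · exact h1
    · exact (M.cross_vert_pos i j).le
    · have h := M.convex i (j + 3)
      have e2 : j + 3 + 2 = j + 1 := by rw [← Fin.add_one_add_one, Fin.add_three_add_one_four]
      rw [Fin.add_three_add_one_four, e2] at h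
      have e : cross (M.vert i (j + 1) - M.vert i j) (M.vert i (j + 3) - M.vert i j)
          = cross (M.vert i j - M.vert i (j + 3)) (M.vert i (j + 1) - M.vert i j) := by
        simp only [cross, PiLp.sub_apply]; ring
      rw [e]; exact h.le

/-- As the center is the mean of the vertices, `m` times this area is the sum of the cross products
of the edge with all vertices. None is negative, and the one at `j + 2` is positive. -/
theorem area_pos (hm : m = 3 ∨ m = 4) (p : ι × Fin m) : 0 < M.area p := by
  obtain ⟨i, j⟩ := p
  have hm0 : (0 : ℝ) < m := by rcases hm with rfl | rfl <;> norm_num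
  have hs : ∑ k, cross (M.vert i (j + 1) - M.vert i j) (M.vert i k - M.vert i j)
      = m * M.area (i, j) := by
    have e : ∀ k, M.vert i k - M.vert i j = M.arm i k - M.arm i j := fun k => (M.arm_sub i k j).symm
    simp only [e]
    rw [← cross_sum_right, Finset.sum_sub_distrib, M.sum_arm, Finset.sum_const, Finset.card_univ,
      Fintype.card_fin, ← Nat.cast_smul_eq_nsmul ℝ, area]
    simp only [cross, PiLp.sub_apply, PiLp.smul_apply, PiLp.zero_apply, smul_eq_mul]; ring
  have hpos : 0 < ∑ k, cross (M.vert i (j + 1) - M.vert i j) (M.vert i k - M.vert i j) :=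
    Finset.sum_pos' (fun k _ => M.cross_vert_nonneg hm i j k)
      ⟨j + 2, Finset.mem_univ _, M.cross_vert_pos i j⟩
  rw [hs] at hpos
  exact pos_of_mul_pos_right hpos hm0.le

theorem vert_ne (i : ι) (j : Fin m) : M.vert i j ≠ M.vert i (j + 1) := by
  intro h
  have := M.cross_vert_pos i j
  rw [h] at this
  simp [cross] at this

theorem center_mem (i : ι) : center M.vert i ∈ element M.vert i := by
  have hm0 : (0 : ℝ) < m := Nat.cast_pos.2 (Nat.pos_of_ne_zero (NeZero.ne m))
  rw [_root_.center, Finset.smul_sum]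
  exact (convex_convexHull ℝ _).sum_mem (fun _ _ => by positivity)
    (by simp [hm0.ne']) fun j _ => subset_convexHull ℝ _ (mem_range_self j)

theorem vert_mem (i : ι) (j : Fin m) : M.vert i j ∈ element M.vert i :=
  subset_convexHull ℝ _ (mem_range_self j)

theorem subTriangle_subset (i : ι) (j : Fin m) : subTriangle M.vert i j ⊆ element M.vert i := by
  refine convexHull_min ?_ (convex_convexHull ℝ _)
  rintro x (rfl | rfl | rfl)
  exacts [M.center_mem i, M.vert_mem i j, M.vert_mem i _]

theorem cross_nonneg_of_mem_element (hm : m = 3 ∨ m = 4) {i : ι} {y : Plane}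
    (hy : y ∈ element M.vert i) (j : Fin m) :
    0 ≤ cross (M.vert i (j + 1) - M.vert i j) (y - M.vert i j) := by
  refine convexHull_min (t := {y | 0 ≤ cross (M.vert i (j + 1) - M.vert i j) (y - M.vert i j)})
    ?_ ?_ hy
  · rintro _ ⟨k, rfl⟩
    exact M.cross_vert_nonneg hm i j k
  · intro a ha b hb s t hs ht hst
    obtain rfl : t = 1 - s := by linarith
    have e : s • a + (1 - s) • b - M.vert i j
        = s • (a - M.vert i j) + (1 - s) • (b - M.vert i j) := by module
    simp only [mem_ofPred_eq] at ha hb ⊢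
    rw [e, cross_add_right, cross_smul_right, cross_smul_right]
    positivity

theorem mem_subTriangle_iff (hm : m = 3 ∨ m = 4) {i : ι} {j : Fin m} {y : Plane} :
    y ∈ subTriangle M.vert i j ↔ 0 ≤ cross (M.arm i j) (y - center M.vert i) ∧
      0 ≤ cross (y - center M.vert i) (M.arm i (j + 1)) ∧
      0 ≤ cross (M.vert i (j + 1) - M.vert i j) (y - M.vert i j) :=
  ⟨fun h => cross_nonneg_of_mem_triangle (M.area_pos hm (i, j)) h,
    fun h => mem_triangle_of_cross (M.area_pos hm (i, j)) h.1 h.2.1 h.2.2⟩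

/-- The cross products of the arms with `y - center` sum to zero, so somewhere around the element
they pass from nonnegative to nonpositive. That index is the sector containing `y`. -/
theorem exists_mem_subTriangle_of_cross (hm : m = 3 ∨ m = 4) {i : ι} {y : Plane}
    (hy : ∀ j, 0 ≤ cross (M.vert i (j + 1) - M.vert i j) (y - M.vert i j)) :
    ∃ j, y ∈ subTriangle M.vert i j := by
  obtain ⟨j, h1, h2⟩ := Fin.exists_nonneg_nonpos
    (fun j => cross (M.arm i j) (y - center M.vert i))
    (by rw [← cross_sum_left, M.sum_arm]; simp [cross])
  refine ⟨j, (M.mem_subTriangle_iff hm).2 ⟨h1, ?_, hy j⟩⟩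
  rw [cross_swap]
  linarith

theorem exists_mem_subTriangle (hm : m = 3 ∨ m = 4) {i : ι} {y : Plane}
    (hy : y ∈ element M.vert i) : ∃ j, y ∈ subTriangle M.vert i j :=
  M.exists_mem_subTriangle_of_cross hm fun j => M.cross_nonneg_of_mem_element hm hy j

theorem isCompact_element (i : ι) : IsCompact (element M.vert i) :=
  (toFinite _).isCompact_convexHull (𝕜 := ℝ)

theorem measurableSet_subTriangle (i : ι) (j : Fin m) : MeasurableSet (subTriangle M.vert i j) :=
  measurableSet_convexHull_finite (toFinite _)

theorem volume_subTriangle (hm : m = 3 ∨ m = 4) (p : ι × Fin m) :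
    volume (subTriangle M.vert p.1 p.2) = ENNReal.ofReal (M.area p) * volume stdTriangle := by
  rw [subTriangle, volume_triangle]
  congr 2
  exact abs_of_pos (M.area_pos hm p)

theorem interior_subTriangle_nonempty (hm : m = 3 ∨ m = 4) (p : ι × Fin m) :
    (interior (subTriangle M.vert p.1 p.2)).Nonempty :=
  interior_triangle_nonempty (M.area_pos hm p)

/-- Neighboring subtriangles are separated by the line of their common arm. Opposite ones in a
quadrilateral are separated by a line through the center. -/
theorem volume_subTriangle_inter_of_fst_eq (hm : m = 3 ∨ m = 4) (i : ι) {j k : Fin m}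
    (h : j ≠ k) : volume (subTriangle M.vert i j ∩ subTriangle M.vert i k) = 0 := by
  have adj : ∀ j, volume (subTriangle M.vert i j ∩ subTriangle M.vert i (j + 1)) = 0 := by
    intro j
    refine measure_mono_null ?_ (volume_line (u := M.arm i (j + 1))
      (right_ne_zero_of_cross_ne (M.area_pos hm (i, j)).ne') (center M.vert i))
    rintro y ⟨h1, h2⟩
    have h1' := ((M.mem_subTriangle_iff hm).1 h1).2.1
    have h2' := ((M.mem_subTriangle_iff hm).1 h2).1
    rw [cross_swap] at h1'
    exact le_antisymm (by linarith) h2'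
  rcases Fin.ne_cases hm h with rfl | rfl | ⟨rfl, rfl⟩
  · exact adj j
  · rw [inter_comm]; exact adj k
  -- The separating line points from the center to the midpoint of the edge between vertices `j + 1`
  -- and `j + 2`; as the arms sum to zero, it also passes through the midpoint of the opposite edge.
  · set u := M.arm i (j + 1) + M.arm i (j + 2) with hu
    have hs := M.sum_arm i
    rw [Fin.sum_four_cyclic _ j] at hs
    have h03 : u = -(M.arm i j + M.arm i (j + 3)) := by
      rw [eq_neg_iff_add_eq_zero, ← hs, hu]; abel
    have a1 := M.area_pos hm (i, j + 1)
    have a3 := M.area_pos hm (i, j + 3)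
    simp only [area, Fin.add_one_add_one, Fin.add_three_add_one_four] at a1 a3
    have c0 : 0 < cross (M.arm i j) u := by
      rw [h03, cross_neg_right, cross_add_right, cross_same, cross_swap (M.arm i (j + 3))]
      linarith
    have c1 : 0 < cross (M.arm i (j + 1)) u := by
      rw [hu, cross_add_right, cross_same]; linarith
    have c2 : cross (M.arm i (j + 2)) u < 0 := by
      rw [hu, cross_add_right, cross_same, cross_swap (M.arm i (j + 1))]; linarith
    have c3 : cross (M.arm i (j + 3)) u < 0 := by
      rw [h03, cross_neg_right, cross_add_right, cross_same]; linarith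
    refine measure_mono_null ?_ (volume_line (u := u) (right_ne_zero_of_cross_ne c0.ne')
      (center M.vert i))
    rintro y ⟨h1, h2⟩
    obtain ⟨α, β, hα, hβ, -, rfl⟩ := mem_triangle.1 h1
    obtain ⟨α', β', hα', hβ', -, e⟩ := mem_triangle.1 h2
    change _ = _ + (α' • M.arm i (j + 2) + β' • M.arm i (j + 2 + 1)) at e
    change cross u (_ + (α • M.arm i j + β • M.arm i (j + 1)) - _) = 0
    have e0 := add_left_cancel e
    rw [add_sub_cancel_left, cross_swap]
    have hp : 0 ≤ cross (α • M.arm i j + β • M.arm i (j + 1)) u := by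
      rw [cross_add_left, cross_smul_left, cross_smul_left]; positivity
    have hn : cross (α' • M.arm i (j + 2) + β' • M.arm i (j + 2 + 1)) u ≤ 0 := by
      rw [cross_add_left, cross_smul_left, cross_smul_left, Fin.add_two_add_one]
      nlinarith
    have hn' : cross (α • M.arm i j + β • M.arm i (j + 1)) u ≤ 0 := by
      refine le_of_eq_of_le (congrArg (fun z => cross z u) ?_) hn
      exact e0
    linarith

theorem volume_element_inter {i k : ι} (h : i ≠ k) :
    volume (element M.vert i ∩ element M.vert k) = 0 := by
  rcases M.conforming i k h with h | ⟨j, _, -, h⟩ | ⟨j, _, -, -, h⟩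
  · rw [disjoint_iff_inter_eq_empty.1 h, measure_empty]
  · rw [h]; exact measure_singleton _
  · rw [h]; exact volume_segment _ _ (M.vert_ne i j)

theorem volume_subTriangle_inter (hm : m = 3 ∨ m = 4) {p q : ι × Fin m} (h : p ≠ q) :
    volume (subTriangle M.vert p.1 p.2 ∩ subTriangle M.vert q.1 q.2) = 0 := by
  obtain ⟨i, j⟩ := p
  obtain ⟨k, l⟩ := q
  by_cases e : i = k
  · subst e
    exact M.volume_subTriangle_inter_of_fst_eq hm i fun e => h (congrArg _ e)
  · exact measure_mono_null (inter_subset_inter (M.subTriangle_subset i j)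
      (M.subTriangle_subset k l)) (M.volume_element_inter e)

/-! ### Halves of the subtriangles -/

/-- The half of a subtriangle at its first vertex. -/
def firstHalf (p : ι × Fin m) : Set Plane :=
  convexHull ℝ {center M.vert p.1, M.vert p.1 p.2, midpoint ℝ (M.vert p.1 p.2) (M.vert p.1 (p.2 + 1))}

/-- The half of a subtriangle at its second vertex. -/
def secondHalf (p : ι × Fin m) : Set Plane :=
  convexHull ℝ {center M.vert p.1, midpoint ℝ (M.vert p.1 p.2) (M.vert p.1 (p.2 + 1)),
    M.vert p.1 (p.2 + 1)}

theorem subTriangle_eq_union (p : ι × Fin m) :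
    subTriangle M.vert p.1 p.2 = M.firstHalf p ∪ M.secondHalf p :=
  triangle_eq_union_midpoint _ _ _

theorem midpoint_sub_center (i : ι) (j k : Fin m) :
    midpoint ℝ (M.vert i j) (M.vert i k) - center M.vert i
      = (1 / 2 : ℝ) • (M.arm i j + M.arm i k) := by
  rw [midpoint_eq_smul_add, arm, arm]; norm_num; module

theorem cross_firstHalf (p : ι × Fin m) : cross (M.vert p.1 p.2 - center M.vert p.1)
    (midpoint ℝ (M.vert p.1 p.2) (M.vert p.1 (p.2 + 1)) - center M.vert p.1) = M.area p / 2 := by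
  rw [midpoint_sub_center, cross_smul_right, cross_add_right, ← arm, cross_same, area]; ring

theorem cross_secondHalf (p : ι × Fin m) :
    cross (midpoint ℝ (M.vert p.1 p.2) (M.vert p.1 (p.2 + 1)) - center M.vert p.1)
      (M.vert p.1 (p.2 + 1) - center M.vert p.1) = M.area p / 2 := by
  rw [midpoint_sub_center, cross_smul_left, cross_add_left, ← arm, cross_same, area]; ring

theorem volume_firstHalf (hm : m = 3 ∨ m = 4) (p : ι × Fin m) :
    volume (M.firstHalf p) = ENNReal.ofReal (M.area p / 2) * volume stdTriangle := by
  rw [firstHalf, volume_triangle, cross_firstHalf, abs_of_pos (half_pos (M.area_pos hm p))]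

theorem volume_secondHalf (hm : m = 3 ∨ m = 4) (p : ι × Fin m) :
    volume (M.secondHalf p) = ENNReal.ofReal (M.area p / 2) * volume stdTriangle := by
  rw [secondHalf, volume_triangle, cross_secondHalf, abs_of_pos (half_pos (M.area_pos hm p))]

theorem volume_halves_inter (hm : m = 3 ∨ m = 4) (p : ι × Fin m) :
    volume (M.firstHalf p ∩ M.secondHalf p) = 0 := by
  have h1 := M.cross_firstHalf p
  have h2 := M.cross_secondHalf p
  have hA := half_pos (M.area_pos hm p)
  refine measure_mono_null ?_ (volume_line (right_ne_zero_of_cross_ne (h1.trans_ne hA.ne'))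
    (center M.vert p.1))
  rintro y ⟨hy1, hy2⟩
  have k1 := (cross_nonneg_of_mem_triangle (h1.symm ▸ hA) hy1).2.1
  have k2 := (cross_nonneg_of_mem_triangle (h2.symm ▸ hA) hy2).1
  rw [cross_swap] at k1
  exact le_antisymm (by linarith) k2

/-- The quadrilateral is cut along the diagonal from center to vertex, which needs its angle at the
center to be at most `π`. The corresponding cross product is, up to a positive factor, the area of
one subtriangle of a triangle, or the sum of the areas of two opposite subtriangles of a
quadrilateral. -/
theorem vertexCell_eq_union (hm : m = 3 ∨ m = 4) (i : ι) (j : Fin m) :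
    vertexCell M.vert (i, j + 1) = M.secondHalf (i, j) ∪ M.firstHalf (i, j + 1) := by
  have hA := half_pos (M.area_pos hm (i, j))
  have hA' := half_pos (M.area_pos hm (i, j + 1))
  rw [vertexCell, secondHalf, firstHalf]
  simp only [add_sub_cancel_right]
  refine quadrilateral_eq_union ((M.cross_secondHalf (i, j)).symm ▸ hA)
    ((M.cross_firstHalf (i, j + 1)).symm ▸ hA') ?_ ?_
  · rw [midpoint_sub_center, midpoint_sub_center, cross_smul_left, cross_smul_right,
      Fin.add_one_add_one]
    have hs := M.sum_arm i
    have key : 0 ≤ cross (M.arm i j + M.arm i (j + 1)) (M.arm i (j + 1) + M.arm i (j + 2)) := by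
      rcases hm with rfl | rfl
      · rw [Fin.sum_three_cyclic _ j] at hs
        have e1 : M.arm i j + M.arm i (j + 1) = -M.arm i (j + 2) := eq_neg_of_add_eq_zero_left hs
        have a := M.area_pos (Or.inl rfl) (i, j + 1)
        simp only [area, Fin.add_one_add_one] at a
        rw [e1, cross_neg_left, cross_add_right, cross_same, cross_swap (M.arm i (j + 1))]
        linarith
      · rw [Fin.sum_four_cyclic _ j] at hs
        have e1 : M.arm i (j + 2) = -(M.arm i j + M.arm i (j + 1) + M.arm i (j + 3)) := by
          rw [eq_neg_iff_add_eq_zero, ← hs]; abel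
        have e2 : M.arm i j = -(M.arm i (j + 1) + M.arm i (j + 2) + M.arm i (j + 3)) := by
          rw [eq_neg_iff_add_eq_zero, ← hs]; abel
        have a0 := M.area_pos (Or.inr rfl) (i, j)
        have a2 := M.area_pos (Or.inr rfl) (i, j + 2)
        simp only [area, Fin.add_two_add_one] at a0 a2
        have e : cross (M.arm i j + M.arm i (j + 1)) (M.arm i (j + 1) + M.arm i (j + 2))
            = cross (M.arm i j) (M.arm i (j + 1)) + cross (M.arm i (j + 2)) (M.arm i (j + 3)) := by
          have e3 : M.arm i (j + 3) = -(M.arm i j + M.arm i (j + 1) + M.arm i (j + 2)) := by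
            rw [eq_neg_iff_add_eq_zero, ← hs]; abel
          rw [e3]
          simp only [cross, PiLp.add_apply, PiLp.neg_apply]; ring
        rw [e]; exact (add_pos a0 a2).le
    positivity
  · have h := M.convex i j
    have e1 : M.vert i (j + 1) - midpoint ℝ (M.vert i j) (M.vert i (j + 1))
        = (1 / 2 : ℝ) • (M.vert i (j + 1) - M.vert i j) := by
      rw [midpoint_eq_smul_add]; norm_num; module
    have e2 : midpoint ℝ (M.vert i (j + 1)) (M.vert i (j + 1 + 1)) - M.vert i (j + 1)
        = (1 / 2 : ℝ) • (M.vert i (j + 2) - M.vert i (j + 1)) := by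
      rw [midpoint_eq_smul_add, Fin.add_one_add_one]; norm_num; module
    rw [e1, e2, cross_smul_left, cross_smul_right]
    positivity

end Mesh

namespace Mesh

/-! ### The subdivisions partition the domain -/

variable {m : ℕ} [NeZero m] {ι : Type} {Ω : Set Plane} (M : Mesh m ι Ω)

include M in
theorem isOpen_domain : IsOpen Ω := M.cover ▸ isOpen_interior

theorem domain_subset : Ω ⊆ ⋃ i, element M.vert i := by
  conv_lhs => rw [← M.cover]
  exact interior_subset

theorem interior_element_subset (i : ι) : interior (element M.vert i) ⊆ Ω := by
  conv_rhs => rw [← M.cover]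
  exact interior_mono (subset_iUnion _ i)

theorem exists_mem_subTriangle_of_mem_domain (hm : m = 3 ∨ m = 4) {x : Plane} (hx : x ∈ Ω) :
    ∃ p : ι × Fin m, x ∈ subTriangle M.vert p.1 p.2 := by
  obtain ⟨i, hi⟩ := mem_iUnion.1 (M.domain_subset hx)
  obtain ⟨j, hj⟩ := M.exists_mem_subTriangle hm hi
  exact ⟨(i, j), hj⟩

/-- `Ω` contains the interior of the element, and a convex set has null frontier. Hence integrals
over cells within `Ω` carry the full areas of the subtriangles. -/
theorem volume_element_diff (i : ι) : volume (element M.vert i \ Ω) = 0 := by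
  refine measure_mono_null ?_ ((convex_convexHull ℝ (range (M.vert i))).addHaar_frontier volume)
  rintro x ⟨hx, hxΩ⟩
  exact ⟨subset_closure hx, fun h => hxΩ (M.interior_element_subset i h)⟩

theorem volume_subTriangle_diff (p : ι × Fin m) :
    volume (subTriangle M.vert p.1 p.2 \ Ω) = 0 :=
  measure_mono_null (sdiff_subset_sdiff_left (M.subTriangle_subset p.1 p.2))
    (M.volume_element_diff p.1)

theorem restrict_domain {T : Set Plane} (hT : MeasurableSet T) (h : volume (T \ Ω) = 0) :
    (volume.restrict Ω).restrict T = volume.restrict T := by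
  rw [Measure.restrict_restrict hT]
  refine Measure.restrict_congr_set ?_
  exact eventuallyLE_antisymm_iff.2 ⟨ae_le_set.2 (by simp [inter_sdiff_assoc]), ae_le_set.2 (by
    rwa [sdiff_inter, sdiff_self, empty_union])⟩

theorem edgeCell_congr {p q : ι × Fin m} (h : edge M.vert p.1 p.2 = edge M.vert q.1 q.2) :
    edgeCell M.vert p = edgeCell M.vert q := by
  rw [edgeCell, edgeCell, h]

theorem subTriangle_subset_edgeCell {p q : ι × Fin m}
    (h : edge M.vert q.1 q.2 = edge M.vert p.1 p.2) :
    subTriangle M.vert q.1 q.2 ⊆ edgeCell M.vert p :=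
  subset_biUnion_of_mem (u := fun q : ι × Fin m => subTriangle M.vert q.1 q.2) h

theorem firstHalf_subset (p : ι × Fin m) : M.firstHalf p ⊆ subTriangle M.vert p.1 p.2 :=
  M.subTriangle_eq_union p ▸ subset_union_left

theorem secondHalf_subset (p : ι × Fin m) : M.secondHalf p ⊆ subTriangle M.vert p.1 p.2 :=
  M.subTriangle_eq_union p ▸ subset_union_right

theorem volume_secondHalf_inter_firstHalf (hm : m = 3 ∨ m = 4) (p q : ι × Fin m) :
    volume (M.secondHalf p ∩ M.firstHalf q) = 0 := by
  by_cases h : p = q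
  · subst h
    rw [inter_comm]
    exact M.volume_halves_inter hm p
  · exact measure_mono_null (inter_subset_inter (M.secondHalf_subset p) (M.firstHalf_subset q))
      (M.volume_subTriangle_inter hm h)

theorem vertexCell_eq (hm : m = 3 ∨ m = 4) (p : ι × Fin m) :
    vertexCell M.vert p = M.secondHalf (p.1, p.2 - 1) ∪ M.firstHalf p := by
  have := M.vertexCell_eq_union hm p.1 (p.2 - 1)
  rwa [sub_add_cancel] at this

theorem volume_vertexCell_inter (hm : m = 3 ∨ m = 4) {p q : ι × Fin m} (h : p ≠ q) :
    volume (vertexCell M.vert p ∩ vertexCell M.vert q) = 0 := by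
  have h' : (p.1, p.2 - 1) ≠ (q.1, q.2 - 1) := fun e =>
    h (Prod.ext (Prod.mk.inj e).1 (sub_left_injective (Prod.mk.inj e).2))
  rw [M.vertexCell_eq hm, M.vertexCell_eq hm, union_inter_distrib_right, inter_union_distrib_left,
    inter_union_distrib_left]
  refine measure_union_null (measure_union_null ?_ ?_) (measure_union_null ?_ ?_)
  · exact measure_mono_null (inter_subset_inter (M.secondHalf_subset _) (M.secondHalf_subset _))
      (M.volume_subTriangle_inter hm h')
  · exact M.volume_secondHalf_inter_firstHalf hm _ _
  · rw [inter_comm]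
    exact M.volume_secondHalf_inter_firstHalf hm _ _
  · exact measure_mono_null (inter_subset_inter (M.firstHalf_subset _) (M.firstHalf_subset _))
      (M.volume_subTriangle_inter hm h)

variable [Fintype ι]

theorem volume_edgeCell_inter (hm : m = 3 ∨ m = 4) {p q : ι × Fin m}
    (h : edge M.vert p.1 p.2 ≠ edge M.vert q.1 q.2) :
    volume (edgeCell M.vert p ∩ edgeCell M.vert q) = 0 := by
  rw [edgeCell, edgeCell, iUnion₂_inter]
  simp only [inter_iUnion]
  refine (measure_biUnion_null_iff (to_countable _)).2 fun p' hp' =>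
    (measure_biUnion_null_iff (to_countable _)).2 fun q' hq' => M.volume_subTriangle_inter hm ?_
  rintro rfl
  exact h (Eq.trans (Eq.symm hp') hq')

theorem volume_edgeCell_ne_top (p : ι × Fin m) : volume (edgeCell M.vert p) ≠ ⊤ :=
  ((toFinite _).isCompact_biUnion fun _ _ =>
    ((toFinite _).isCompact_convexHull (𝕜 := ℝ))).measure_lt_top.ne

/-- Cells depend only on the edge as a set, so both occurrences of an interior edge yield the same
cell, and distinct cells are unions of disjoint families of subtriangles. -/
theorem isPartition_edgeSubdivision (hm : m = 3 ∨ m = 4) : M.edgeSubdivision.IsPartition Ω where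
  aedisjoint := by
    intro T hT T' hT' hne
    obtain ⟨p, -, rfl⟩ := Finset.mem_image.1 hT
    obtain ⟨q, -, rfl⟩ := Finset.mem_image.1 hT'
    exact Measure.absolutelyContinuous_of_le Measure.restrict_le_self
      (M.volume_edgeCell_inter hm fun e => hne (M.edgeCell_congr e))
  cover := by
    filter_upwards [ae_restrict_mem M.isOpen_domain.measurableSet] with x hx
    obtain ⟨p, hp⟩ := M.exists_mem_subTriangle_of_mem_domain hm hx
    exact ⟨_, Finset.mem_image_of_mem _ (Finset.mem_univ p), M.subTriangle_subset_edgeCell rfl hp⟩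
  finite := by
    intro T hT
    obtain ⟨p, -, rfl⟩ := Finset.mem_image.1 hT
    exact ((Measure.le_iff'.1 Measure.restrict_le_self _).trans_lt
      (M.volume_edgeCell_ne_top p).lt_top).ne

theorem isPartition_vertexSubdivision (hm : m = 3 ∨ m = 4) :
    M.vertexSubdivision.IsPartition Ω where
  aedisjoint := by
    intro T hT T' hT' hne
    obtain ⟨p, -, rfl⟩ := Finset.mem_image.1 hT
    obtain ⟨q, -, rfl⟩ := Finset.mem_image.1 hT'
    exact Measure.absolutelyContinuous_of_le Measure.restrict_le_self
      (M.volume_vertexCell_inter hm fun e => hne (congrArg _ e))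
  cover := by
    filter_upwards [ae_restrict_mem M.isOpen_domain.measurableSet] with x hx
    obtain ⟨p, hp⟩ := M.exists_mem_subTriangle_of_mem_domain hm hx
    rw [subTriangle_eq_union] at hp
    rcases hp with hp | hp
    · refine ⟨_, Finset.mem_image_of_mem _ (Finset.mem_univ p), ?_⟩
      rw [M.vertexCell_eq hm]
      exact Or.inr hp
    · refine ⟨_, Finset.mem_image_of_mem _ (Finset.mem_univ (p.1, p.2 + 1)), ?_⟩
      rw [M.vertexCell_eq_union hm]
      exact Or.inl hp
  finite := by
    intro T hT
    obtain ⟨p, -, rfl⟩ := Finset.mem_image.1 hT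
    exact ((Measure.le_iff'.1 Measure.restrict_le_self _).trans_lt
      ((toFinite _).isCompact_convexHull (𝕜 := ℝ)).measure_lt_top).ne

/-! ### Fields that are constant on subtriangles -/

/-- The field `ε` has the constant value `e p` on the `p`-th subtriangle. -/
def HasValues (M : Mesh m ι Ω) (ε : StrainL2 Ω) (e : ι × Fin m → Voigt) : Prop :=
  ∀ p : ι × Fin m, ∀ᵐ x ∂(volume.restrict Ω), x ∈ subTriangle M.vert p.1 p.2 → ε x = e p

omit [Fintype ι] in
theorem setIntegral_of_subset {ε : StrainL2 Ω} {e : ι × Fin m → Voigt}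
    (h : M.HasValues ε e) {p : ι × Fin m} {T : Set Plane} (hT : MeasurableSet T)
    (hTp : T ⊆ subTriangle M.vert p.1 p.2) :
    ∫ x in T, ε x ∂(volume.restrict Ω) = volume.real T • e p := by
  rw [setIntegral_congr_ae (g := fun _ => e p) hT ((h p).mono fun x hx hxT => hx (hTp hxT)),
    restrict_domain hT (measure_mono_null (sdiff_subset_sdiff_left hTp)
      (M.volume_subTriangle_diff p)), setIntegral_const]

open Classical in
/-- The subtriangles on the same edge as the `p`-th one. -/
def sameEdge (p : ι × Fin m) : Finset (ι × Fin m) :=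
  Finset.univ.filter fun q => edge M.vert q.1 q.2 = edge M.vert p.1 p.2

theorem mem_sameEdge {p q : ι × Fin m} :
    q ∈ M.sameEdge p ↔ edge M.vert q.1 q.2 = edge M.vert p.1 p.2 := by
  simp [sameEdge]

theorem volume_real_stdTriangle_pos : 0 < volume.real stdTriangle :=
  ENNReal.toReal_pos volume_stdTriangle_ne_zero volume_stdTriangle_ne_top

theorem setIntegral_edgeCell (hm : m = 3 ∨ m = 4) {ε : StrainL2 Ω} {e : ι × Fin m → Voigt}
    (h : M.HasValues ε e) (p : ι × Fin m) :
    ∫ x in edgeCell M.vert p, ε x ∂(volume.restrict Ω)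
      = volume.real stdTriangle • ∑ q ∈ M.sameEdge p, M.area q • e q := by
  have hU : edgeCell M.vert p = ⋃ q : M.sameEdge p, subTriangle M.vert q.1.1 q.1.2 := by
    rw [iUnion_subtype]
    simp only [edgeCell, mem_sameEdge, mem_ofPred_eq]
  have hint : IntegrableOn ε (edgeCell M.vert p) (volume.restrict Ω) :=
    (M.isPartition_edgeSubdivision hm).integrableOn_cell ε
      (Finset.mem_image_of_mem _ (Finset.mem_univ p))
  rw [hU] at hint ⊢
  rw [integral_iUnion_ae (fun q => (M.measurableSet_subTriangle _ _).nullMeasurableSet) ?_ hint,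
    tsum_fintype, Finset.smul_sum]
  · refine Eq.trans (Finset.sum_congr rfl fun q _ => ?_) (Finset.sum_coe_sort (M.sameEdge p)
      fun q => volume.real stdTriangle • M.area q • e q)
    rw [M.setIntegral_of_subset h (M.measurableSet_subTriangle _ _) Subset.rfl, Measure.real,
      M.volume_subTriangle hm, ENNReal.toReal_mul, ENNReal.toReal_ofReal (M.area_pos hm _).le,
      smul_smul, mul_comm]
    rfl
  · intro q q' hq
    exact Measure.absolutelyContinuous_of_le Measure.restrict_le_self
      (M.volume_subTriangle_inter hm fun e => hq (Subtype.ext e))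

/-- The cell takes exactly half of each of two consecutive subtriangles, so the factor `1 / 2` is
common and the weights remain their areas. -/
theorem setIntegral_vertexCell (hm : m = 3 ∨ m = 4) {ε : StrainL2 Ω} {e : ι × Fin m → Voigt}
    (h : M.HasValues ε e) (i : ι) (j : Fin m) :
    ∫ x in vertexCell M.vert (i, j + 1), ε x ∂(volume.restrict Ω)
      = (volume.real stdTriangle / 2) •
        (M.area (i, j) • e (i, j) + M.area (i, j + 1) • e (i, j + 1)) := by
  have hint : IntegrableOn ε (vertexCell M.vert (i, j + 1)) (volume.restrict Ω) :=
    (M.isPartition_vertexSubdivision hm).integrableOn_cell ε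
      (Finset.mem_image_of_mem _ (Finset.mem_univ (i, j + 1)))
  have m1 : MeasurableSet (M.secondHalf (i, j)) := measurableSet_convexHull_finite (toFinite _)
  have m2 : MeasurableSet (M.firstHalf (i, j + 1)) := measurableSet_convexHull_finite (toFinite _)
  rw [M.vertexCell_eq_union hm] at hint ⊢
  rw [setIntegral_union₀ (Measure.absolutelyContinuous_of_le Measure.restrict_le_self
      (M.volume_secondHalf_inter_firstHalf hm _ _)) m2.nullMeasurableSet
      (hint.mono_set subset_union_left) (hint.mono_set subset_union_right),
    M.setIntegral_of_subset h m1 (M.secondHalf_subset _),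
    M.setIntegral_of_subset h m2 (M.firstHalf_subset _), Measure.real, Measure.real,
    M.volume_secondHalf hm, M.volume_firstHalf hm, ENNReal.toReal_mul, ENNReal.toReal_mul,
    ENNReal.toReal_ofReal (half_pos (M.area_pos hm _)).le,
    ENNReal.toReal_ofReal (half_pos (M.area_pos hm _)).le, Measure.real]
  module

/-- The values on the subtriangles of the smoothed field `P₁ ε`. -/
theorem exists_hasValues_P₁ (hm : m = 3 ∨ m = 4) {ε : StrainL2 Ω} {e : ι × Fin m → Voigt}
    (h : M.HasValues ε e) : ∃ E : ι × Fin m → Voigt, M.HasValues (M.P₁ ε) E ∧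
      (∀ p, ∀ q ∈ M.sameEdge p, E q = E p) ∧
      ∀ p, ∑ q ∈ M.sameEdge p, M.area q • e q = (∑ q ∈ M.sameEdge p, M.area q) • E p := by
  have hP := M.isPartition_edgeSubdivision hm
  have hcell : ∀ p, edgeCell M.vert p ∈ M.edgeSubdivision.cells :=
    fun p => Finset.mem_image_of_mem _ (Finset.mem_univ p)
  let E : ι × Fin m → Voigt := fun p => ⨍ y in edgeCell M.vert p, ε y ∂(volume.restrict Ω)
  have hE : M.HasValues (M.P₁ ε) E := fun p => (hP.smoothing_ae ε).mono fun x hx hxp =>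
    hx _ (hcell p) (M.subTriangle_subset_edgeCell rfl hxp)
  have hEq : ∀ p, ∀ q ∈ M.sameEdge p, E q = E p := fun p q hq => by
    simp only [E, M.edgeCell_congr (M.mem_sameEdge.1 hq)]
  refine ⟨E, hE, hEq, fun p => ?_⟩
  have h1 := hP.setIntegral_smoothing ε (hcell p)
  change ∫ x in edgeCell M.vert p, M.P₁ ε x ∂(volume.restrict Ω) = _ at h1
  rw [M.setIntegral_edgeCell hm hE, M.setIntegral_edgeCell hm h] at h1
  have h2 := smul_right_injective Voigt volume_real_stdTriangle_pos.ne' h1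
  rw [← h2, Finset.sum_smul]
  exact Finset.sum_congr rfl fun q hq => by rw [hEq p q hq]

theorem area_smul_add_eq_zero (hm : m = 3 ∨ m = 4) {ε : StrainL2 Ω} {e : ι × Fin m → Voigt}
    (h : M.HasValues ε e) (h0 : M.P₂ ε = 0) (i : ι) (j : Fin m) :
    M.area (i, j) • e (i, j) + M.area (i, j + 1) • e (i, j + 1) = 0 := by
  have hP := M.isPartition_vertexSubdivision hm
  have h1 := hP.setIntegral_smoothing ε
    (Finset.mem_image_of_mem (vertexCell M.vert) (Finset.mem_univ (i, j + 1)))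
  change ∫ x in _, M.P₂ ε x ∂(volume.restrict Ω) = _ at h1
  rw [M.setIntegral_vertexCell hm h, h0,
    integral_congr_ae (ae_restrict_of_ae (Lp.coeFn_zero Voigt 2 (volume.restrict Ω)))] at h1
  simp only [Pi.zero_apply, integral_zero] at h1
  exact (smul_eq_zero.1 h1.symm).resolve_left (half_pos volume_real_stdTriangle_pos).ne'

end Mesh

/-! ### Strains of piecewise affine fields -/

/-- Integration by parts on the whole plane; compact support of `φ` leaves no boundary term and
makes the unbounded affine factor harmless. -/
theorem integral_partialDeriv_smul_affine {φ : Plane → ℝ} (hφ : ContDiff ℝ ∞ φ)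
    (hs : HasCompactSupport φ) (j : Fin 2) (A : Plane →ᵃ[ℝ] Plane) :
    ∫ x, partialDeriv j φ x • A x = -∫ x, φ x • A.linear (EuclideanSpace.single j 1) := by
  let L : Plane →ᴬ[ℝ] Plane := ⟨A, A.continuous_of_finiteDimensional⟩
  have hA : ContDiff ℝ ∞ A := L.contDiff
  have hd : ∀ x, fderiv ℝ A x (EuclideanSpace.single j 1)
      = A.linear (EuclideanSpace.single j 1) := by
    intro x
    have : HasFDerivAt A (LinearMap.toContinuousLinearMap A.linear) x := by
      have h := (LinearMap.toContinuousLinearMap A.linear).hasFDerivAt (x := x)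
      have h2 := h.add_const (A 0)
      refine h2.congr_of_eventuallyEq (Eventually.of_forall fun y => ?_)
      exact congrFun A.decomp y
    rw [this.fderiv]; rfl
  have hc : Continuous (partialDeriv j φ) :=
    (hφ.continuous_fderiv (by simp)).clm_apply continuous_const
  have hs' : HasCompactSupport (partialDeriv j φ) := hs.fderiv_apply (𝕜 := ℝ) _
  have i1 : Integrable fun x => fderiv ℝ φ x (EuclideanSpace.single j 1) • A x :=
    (hc.smul hA.continuous).integrable_of_hasCompactSupport hs'.smul_right
  have i2 : Integrable fun x => φ x • fderiv ℝ A x (EuclideanSpace.single j 1) := by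
    simp only [hd]
    exact (hφ.continuous.smul continuous_const).integrable_of_hasCompactSupport hs.smul_right
  have i3 : Integrable fun x => φ x • A x :=
    (hφ.continuous.smul hA.continuous).integrable_of_hasCompactSupport hs.smul_right
  have := integral_smul_fderiv_eq_neg_fderiv_smul_of_integrable i1 i2 i3
    (fun x _ => hφ.differentiable (by simp) x) (fun x _ => hA.differentiable (by simp) x)
  simp only [hd] at this
  rw [this, neg_neg]
  rfl

/-- Test functions supported in the interior of `t` cannot distinguish `w` from `A`, so the
fundamental lemma of the calculus of variations identifies the derivative there. The frontier of the
convex set `t` is null. -/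
theorem partial_ae_eq_of_affine {Ω : Set Plane} (U : H1 Ω) {w : Plane → Plane}
    (hU : ∀ᵐ x ∂(volume.restrict Ω), H1.val U x = w x) {t : Set Plane} (ht : Convex ℝ t)
    (htΩ : interior t ⊆ Ω) {A : Plane →ᵃ[ℝ] Plane} (hA : EqOn w A t) (j : Fin 2) :
    ∀ᵐ x ∂(volume.restrict Ω), x ∈ t →
      H1.partial U j x = A.linear (EuclideanSpace.single j 1) := by
  set g := A.linear (EuclideanSpace.single j 1)
  have hloc : LocallyIntegrable (fun x => H1.partial U j x - g) (volume.restrict Ω) :=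
    ((Lp.memLp (H1.partial U j)).locallyIntegrable (by norm_num)).sub (locallyIntegrable_const g)
  have h0 : ∀ᵐ x ∂(volume.restrict Ω), x ∈ interior t → H1.partial U j x - g = 0 := by
    refine isOpen_interior.ae_eq_zero_of_integral_contDiff_smul_eq_zero
      (hloc.locallyIntegrableOn _) fun φ hφ hs hsupp => ?_
    have htest : IsTestFunction Ω φ := ⟨hφ, hs, hsupp.trans htΩ⟩
    have h1 := U.2 j φ htest
    have hz : ∀ x, x ∉ Ω → φ x = 0 := fun x hx => image_eq_zero_of_notMem_tsupport
      fun h => hx (htΩ (hsupp h))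
    have hdz : ∀ x, x ∉ interior t → partialDeriv j φ x = 0 := fun x hx => by
      have : x ∉ tsupport (fderiv ℝ φ) := fun h => hx (hsupp (tsupport_fderiv_subset ℝ h))
      rw [partialDeriv, image_eq_zero_of_notMem_tsupport this, zero_apply]
    have h2 : ∫ x in Ω, partialDeriv j φ x • H1.val U x = ∫ x in Ω, partialDeriv j φ x • A x := by
      refine integral_congr_ae (hU.mono fun x hx => ?_)
      change partialDeriv j φ x • H1.val U x = _
      by_cases hxt : x ∈ interior t
      · rw [hx, hA (interior_subset hxt)]
      · simp only [hdz x hxt, zero_smul]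
    have h3 : ∫ x in Ω, partialDeriv j φ x • A x = ∫ x, partialDeriv j φ x • A x :=
      setIntegral_eq_integral_of_forall_compl_eq_zero fun x hx => by
        rw [hdz x fun h => hx (htΩ h), zero_smul]
    have h4 : ∫ x in Ω, φ x • g = ∫ x, φ x • g :=
      setIntegral_eq_integral_of_forall_compl_eq_zero fun x hx => by rw [hz x hx, zero_smul]
    have h5 : Integrable (fun x => φ x • g) (volume.restrict Ω) :=
      ((hφ.continuous.smul continuous_const).integrable_of_hasCompactSupport
        hs.smul_right).restrict
    have h6 := htest.integrable_smul (H1.partial U j)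
    simp only [smul_sub]
    rw [integral_sub h6 h5, h4, sub_eq_zero, ← neg_inj,
      ← integral_partialDeriv_smul_affine hφ hs j A, ← h3, ← h2]
    exact h1.symm
  have hfr : ∀ᵐ x ∂(volume.restrict Ω), x ∉ frontier t :=
    ae_restrict_of_ae (measure_eq_zero_iff_ae_notMem.1 (ht.addHaar_frontier volume))
  filter_upwards [h0, hfr] with x hx hxf hxt
  refine sub_eq_zero.1 (hx ?_)
  by_contra hxi
  exact hxf ⟨subset_closure hxt, hxi⟩

/-- The strain `(∂₀ u₀, ∂₁ u₁, ∂₁ u₀ + ∂₀ u₁)` of the linear field `u = G`. -/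
def symGrad (G : Plane →ₗ[ℝ] Plane) : Voigt :=
  !₂[G (EuclideanSpace.single 0 1) 0, G (EuclideanSpace.single 1 1) 1,
    G (EuclideanSpace.single 1 1) 0 + G (EuclideanSpace.single 0 1) 1]

theorem strain_ae_eq_of_affine {Ω : Set Plane} (U : H1 Ω) {w : Plane → Plane}
    (hU : ∀ᵐ x ∂(volume.restrict Ω), H1.val U x = w x) {t : Set Plane} (ht : Convex ℝ t)
    (htΩ : interior t ⊆ Ω) {A : Plane →ᵃ[ℝ] Plane} (hA : EqOn w A t) :
    ∀ᵐ x ∂(volume.restrict Ω), x ∈ t → strain U x = symGrad A.linear := by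
  unfold strain
  set B₀ := (Matrix.toLpLin 2 2 !![(1 : ℝ), 0; 0, 0; 0, 1]).toContinuousLinearMap with hB₀
  set B₁ := (Matrix.toLpLin 2 2 !![(0 : ℝ), 0; 0, 1; 1, 0]).toContinuousLinearMap with hB₁
  filter_upwards [partial_ae_eq_of_affine U hU ht htΩ hA 0,
    partial_ae_eq_of_affine U hU ht htΩ hA 1, B₀.coeFn_compLp (H1.partial U 0),
    B₁.coeFn_compLp (H1.partial U 1),
    Lp.coeFn_add (B₀.compLp (H1.partial U 0)) (B₁.compLp (H1.partial U 1))] with x h0 h1 e0 e1 e hx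
  rw [e, Pi.add_apply, e0, e1, h0 hx, h1 hx]
  ext k
  fin_cases k <;> simp [hB₀, hB₁, symGrad, Matrix.toLpLin_apply, Matrix.vecHead, Matrix.vecTail,
    add_comm]

/-- The derivative of the squared length of `z` under a displacement with strain `e`, halved. -/
def stretch (e : Voigt) (z : Plane) : ℝ := e 0 * z 0 ^ 2 + e 1 * z 1 ^ 2 + e 2 * (z 0 * z 1)

theorem apply_eq_basis (G : Plane →ₗ[ℝ] Plane) (z : Plane) :
    G z = z 0 • G (EuclideanSpace.single 0 1) + z 1 • G (EuclideanSpace.single 1 1) := by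
  rw [← map_smul, ← map_smul, ← map_add]
  congr 1
  ext k
  fin_cases k <;> simp

/-- The quadratic form of `G` involves only its symmetric part. This translates strain into the
elongation of an edge, which depends on endpoint displacements alone. -/
theorem stretch_symGrad (G : Plane →ₗ[ℝ] Plane) (z : Plane) :
    stretch (symGrad G) z = G z 0 * z 0 + G z 1 * z 1 := by
  rw [apply_eq_basis G z]
  simp [stretch, symGrad]
  ring

/-- A skew map of the plane with a nontrivial zero vanishes. -/
theorem eq_zero_of_symGrad_eq_zero {G : Plane →ₗ[ℝ] Plane} (h : symGrad G = 0) {z : Plane}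
    (hz : z ≠ 0) (hGz : G z = 0) : G = 0 := by
  have h0 : G (EuclideanSpace.single 0 1) 0 = 0 := by simpa [symGrad] using congrArg (fun e => e 0) h
  have h1 : G (EuclideanSpace.single 1 1) 1 = 0 := by simpa [symGrad] using congrArg (fun e => e 1) h
  have h2 : G (EuclideanSpace.single 1 1) 0 + G (EuclideanSpace.single 0 1) 1 = 0 := by
    simpa [symGrad] using congrArg (fun e => e 2) h
  rw [apply_eq_basis] at hGz
  have k0 : z 1 * G (EuclideanSpace.single 1 1) 0 = 0 := by
    simpa [h0] using congrArg (fun e => e 0) hGz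
  have k1 : z 0 * G (EuclideanSpace.single 0 1) 1 = 0 := by
    simpa [h1] using congrArg (fun e => e 1) hGz
  have h3 : G (EuclideanSpace.single 0 1) 1 = -G (EuclideanSpace.single 1 1) 0 := by linarith
  -- By now `G` is a multiple of the rotation by a right angle, so a nonzero kernel vector forces
  -- the multiple to be zero.
  have h4 : G (EuclideanSpace.single 1 1) 0 = 0 := by
    by_contra hne
    apply hz
    have z1 := (mul_eq_zero.1 k0).resolve_right hne
    have z0 := (mul_eq_zero.1 k1).resolve_right (by rw [h3]; exact neg_ne_zero.2 hne)
    ext k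
    fin_cases k <;> simpa
  ext z k
  rw [apply_eq_basis]
  fin_cases k <;> simp [h0, h1, h3, h4]

/-- The strain of a linear field with prescribed values at two vectors, times their cross
product. -/
def crossStrain (P Q p q : Plane) : Voigt :=
  !₂[Q 1 * p 0 - P 1 * q 0, P 0 * q 1 - Q 0 * p 1,
    P 0 * q 0 - Q 0 * p 0 + (Q 1 * p 1 - P 1 * q 1)]

theorem cross_smul_symGrad (G : Plane →ₗ[ℝ] Plane) (P Q : Plane) :
    cross P Q • symGrad G = crossStrain P Q (G P) (G Q) := by
  rw [apply_eq_basis G P, apply_eq_basis G Q]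
  ext k
  fin_cases k <;> simp [symGrad, crossStrain, cross] <;> ring

/-- `crossStrain` is an alternating bilinear map `ω` of the pairs `X = (P, p)` and `Y = (Q, q)`. The
sum is therefore `ω(X₀ + X₂, X₁ + X₃)`, and the second argument is minus the first. -/
theorem crossStrain_alternating_sum {P₀ P₁ P₂ P₃ p₀ p₁ p₂ p₃ : Plane}
    (hP : P₀ + P₁ + P₂ + P₃ = 0) (hp : p₀ + p₁ + p₂ + p₃ = 0) :
    crossStrain P₀ P₁ p₀ p₁ - crossStrain P₁ P₂ p₁ p₂ + crossStrain P₂ P₃ p₂ p₃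
      - crossStrain P₃ P₀ p₃ p₀ = 0 := by
  obtain rfl : P₃ = -(P₀ + P₁ + P₂) := by rw [eq_neg_iff_add_eq_zero, ← hP]; abel
  obtain rfl : p₃ = -(p₀ + p₁ + p₂) := by rw [eq_neg_iff_add_eq_zero, ← hp]; abel
  ext k
  fin_cases k <;> simp [crossStrain] <;> ring

/-- Polar coordinates present the set as an image of the unit circle times `(0, r)`. It is used to
show that single vertices cannot disconnect the domain. -/
theorem isPreconnected_punctured_ball (x : Plane) (r : ℝ) :
    IsPreconnected (Metric.ball x r \ {x}) := by
  have hrank : 1 < Module.rank ℝ Plane := by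
    rw [← Module.finrank_eq_rank, finrank_euclideanSpace_fin]; norm_num
  have h := ((isPreconnected_sphere hrank (0 : Plane) 1).prod
    (isPreconnected_Ioo (a := (0 : ℝ)) (b := r))).image (fun q : Plane × ℝ => x + q.2 • q.1)
    (by fun_prop)
  convert h
  ext y
  constructor
  · rintro ⟨hy, hne⟩
    have hd : 0 < ‖y - x‖ := norm_pos_iff.2 (sub_ne_zero.2 hne)
    refine ⟨(‖y - x‖⁻¹ • (y - x), ‖y - x‖), ⟨?_, hd, mem_ball_iff_norm.1 hy⟩, ?_⟩
    · simp [norm_smul, hd.ne']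
    · simp [smul_smul, hd.ne']
  · rintro ⟨⟨u, t⟩, ⟨hu, ht0, htr⟩, rfl⟩
    have hu1 : ‖u‖ = 1 := by simpa using hu
    refine ⟨?_, ?_⟩
    · simpa [norm_smul, hu1, abs_of_pos ht0] using htr
    · have : u ≠ 0 := norm_ne_zero_iff.1 (by rw [hu1]; norm_num)
      simpa using ⟨(show t ≠ 0 from ht0.ne'), this⟩

namespace Mesh

variable {m : ℕ} [NeZero m] {ι : Type} {Ω : Set Plane} (M : Mesh m ι Ω)

/-! ### Shared edges -/

theorem left_mem_edge (i : ι) (j : Fin m) : M.vert i j ∈ edge M.vert i j := left_mem_segment ℝ _ _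

theorem right_mem_edge (i : ι) (j : Fin m) : M.vert i (j + 1) ∈ edge M.vert i j :=
  right_mem_segment ℝ _ _

theorem cross_eq_zero_of_mem_edge {i : ι} {j : Fin m} {y : Plane} (hy : y ∈ edge M.vert i j) :
    cross (M.vert i (j + 1) - M.vert i j) (y - M.vert i j) = 0 := by
  rw [edge, segment_eq_image'] at hy
  obtain ⟨t, -, rfl⟩ := hy
  simp [cross_smul_right, cross_same]

theorem vert_add_two_notMem_edge (i : ι) (j : Fin m) : M.vert i (j + 2) ∉ edge M.vert i j :=
  fun h => (M.cross_vert_pos i j).ne' (M.cross_eq_zero_of_mem_edge h)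

theorem vert_notMem_edge_add_one (i : ι) (j : Fin m) : M.vert i j ∉ edge M.vert i (j + 1) := by
  intro h
  have h1 := M.cross_eq_zero_of_mem_edge h
  have h2 := M.cross_vert_pos i j
  have e : cross (M.vert i (j + 1) - M.vert i j) (M.vert i (j + 2) - M.vert i j)
      = cross (M.vert i (j + 2) - M.vert i (j + 1)) (M.vert i j - M.vert i (j + 1)) := by
    simp only [cross, PiLp.sub_apply]; ring
  rw [Fin.add_one_add_one] at h1
  rw [e] at h2
  exact h2.ne' h1

theorem edge_subset_element (i : ι) (j : Fin m) : edge M.vert i j ⊆ element M.vert i :=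
  (convex_convexHull ℝ _).segment_subset (M.vert_mem i j) (M.vert_mem i _)

theorem eq_of_edge_subset (hm : m = 3 ∨ m = 4) {i : ι} {j k : Fin m}
    (h : edge M.vert i j ⊆ edge M.vert i k) : j = k := by
  by_contra hne
  rcases Fin.ne_cases hm (Ne.symm hne) with rfl | rfl | ⟨rfl, rfl⟩
  · have := h (M.right_mem_edge i _)
    rw [Fin.add_one_add_one] at this
    exact M.vert_add_two_notMem_edge i k this
  · exact M.vert_notMem_edge_add_one i j (h (M.left_mem_edge i _))
  · exact M.vert_add_two_notMem_edge i k (h (M.left_mem_edge i _))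

/-- Two different subtriangles on the same edge traverse it in opposite directions. -/
theorem opposite_of_edge_eq (hm : m = 3 ∨ m = 4) {p q : ι × Fin m} (hpq : p ≠ q)
    (h : edge M.vert q.1 q.2 = edge M.vert p.1 p.2) :
    p.1 ≠ q.1 ∧ M.vert q.1 q.2 = M.vert p.1 (p.2 + 1) ∧
      M.vert q.1 (q.2 + 1) = M.vert p.1 p.2 := by
  obtain ⟨i, j⟩ := p
  obtain ⟨k, l⟩ := q
  simp only at h ⊢
  have hik : i ≠ k := by
    rintro rfl
    exact hpq (congrArg _ (M.eq_of_edge_subset hm h.ge))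
  have hsub : edge M.vert i j ⊆ element M.vert i ∩ element M.vert k :=
    subset_inter (M.edge_subset_element i j) (h ▸ M.edge_subset_element k l)
  -- The two elements share a whole edge, so they are not disjoint and do not meet in one point. The
  -- common edge supplied by conformity contains the given one, and by strict convexity it is the
  -- same edge in each element.
  rcases M.conforming i k hik with hd | ⟨j', l', -, hs⟩ | ⟨j', l', h1, h2, hs⟩
  · exact (hd.le_bot (hsub (M.left_mem_edge i j))).elim
  · rw [hs] at hsub
    exact (M.vert_ne i j ((hsub (M.left_mem_edge i j)).trans
      (hsub (M.right_mem_edge i j)).symm)).elim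
  · rw [hs] at hsub
    obtain rfl := M.eq_of_edge_subset hm hsub
    have hkl : edge M.vert k l ⊆ edge M.vert k l' := by
      rw [h, edge, edge, h1, h2, segment_symm]
    obtain rfl := M.eq_of_edge_subset hm hkl
    exact ⟨hik, h2.symm, h1.symm⟩

/-- Three subtriangles on one edge would need pairwise opposite orientations, but an edge has only
two. -/
theorem eq_of_edge_eq (hm : m = 3 ∨ m = 4) {p q q' : ι × Fin m} (hpq : p ≠ q) (hpq' : p ≠ q')
    (h : edge M.vert q.1 q.2 = edge M.vert p.1 p.2)
    (h' : edge M.vert q'.1 q'.2 = edge M.vert p.1 p.2) : q = q' := by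
  by_contra hne
  have h1 := (M.opposite_of_edge_eq hm hpq h).2.1
  have h2 := (M.opposite_of_edge_eq hm hpq' h').2.2
  have h3 := (M.opposite_of_edge_eq hm hne (h'.trans h.symm)).2.2
  exact M.vert_ne p.1 p.2 (h2.symm.trans (h3.trans h1))

variable [Fintype ι]

theorem isClosed_biUnion_element (S : Set ι) : IsClosed (⋃ i ∈ S, element M.vert i) :=
  (toFinite S).isClosed_biUnion fun i _ => (M.isCompact_element i).isClosed

/-- The elements of a connected domain are connected through shared edges. -/
theorem edge_connected (hm : m = 3 ∨ m = 4) (hΩ : IsPreconnected Ω) (S : Set ι)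
    (hS : S.Nonempty)
    (h : ∀ p q : ι × Fin m, p ≠ q → edge M.vert q.1 q.2 = edge M.vert p.1 p.2 →
      p.1 ∈ S → q.1 ∈ S) : S = univ := by
  by_contra hne
  obtain ⟨k₀, hk₀⟩ := (ne_univ_iff_exists_notMem S).1 hne
  obtain ⟨i₀, hi₀⟩ := hS
  set K₁ := ⋃ i ∈ S, element M.vert i with hK₁
  set K₂ := ⋃ i ∈ Sᶜ, element M.vert i with hK₂
  let F : Set Plane := range fun p : ι × Fin m => M.vert p.1 p.2
  have hF : F.Finite := finite_range _
  have hcov : Ω ⊆ K₁ ∪ K₂ := by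
    intro x hx
    obtain ⟨i, hi⟩ := mem_iUnion.1 (M.domain_subset hx)
    by_cases hiS : i ∈ S
    · exact Or.inl (mem_biUnion hiS hi)
    · exact Or.inr (mem_biUnion (show i ∈ Sᶜ from hiS) hi)
  -- An element of `S` and one outside it share no edge, so the two closed families can meet only in
  -- vertices.
  have hKF : K₁ ∩ K₂ ⊆ F := by
    rintro x ⟨h1, h2⟩
    obtain ⟨i, hi, hxi⟩ := mem_iUnion₂.1 h1
    obtain ⟨k, hk, hxk⟩ := mem_iUnion₂.1 h2
    have hik : i ≠ k := fun e => hk (e ▸ hi)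
    rcases M.conforming i k hik with hd | ⟨j, l, -, hs⟩ | ⟨j, l, e1, e2, -⟩
    · exact (hd.le_bot ⟨hxi, hxk⟩).elim
    · have : x ∈ ({M.vert i j} : Set Plane) := hs ▸ ⟨hxi, hxk⟩
      exact ⟨(i, j), this.symm⟩
    · refine (hk (h (i, j) (k, l) (fun e => hik (congrArg Prod.fst e)) ?_ hi)).elim
      simp only [edge, e1, e2]
      exact segment_symm ℝ _ _
  have hmeet : ∀ (T : Set ι) (x : Plane) (r : ℝ), 0 < r → x ∈ ⋃ i ∈ T, element M.vert i →
      ((Metric.ball x r \ {x}) ∩ ⋃ i ∈ T, element M.vert i).Nonempty := by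
    intro T x r hr hx
    obtain ⟨i, hi, hxi⟩ := mem_iUnion₂.1 hx
    obtain ⟨y, hyi, hyx⟩ : ∃ y ∈ element M.vert i, y ≠ x := by
      by_cases e : M.vert i 0 = x
      · exact ⟨_, M.vert_mem i (0 + 1), fun e' => M.vert_ne i 0 (e.trans e'.symm)⟩
      · exact ⟨_, M.vert_mem i 0, e⟩
    have hd : 0 < ‖y - x‖ := norm_pos_iff.2 (sub_ne_zero.2 hyx)
    set t := min 1 (r / 2 / ‖y - x‖)
    have ht0 : 0 < t := lt_min one_pos (by positivity)
    refine ⟨x + t • (y - x), ⟨?_, ?_⟩, mem_biUnion hi ?_⟩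
    · rw [mem_ball_iff_norm, add_sub_cancel_left, norm_smul, Real.norm_of_nonneg ht0.le]
      calc t * ‖y - x‖ ≤ r / 2 / ‖y - x‖ * ‖y - x‖ := by gcongr; exact min_le_right _ _
        _ = r / 2 := div_mul_cancel₀ _ hd.ne'
        _ < r := half_lt_self hr
    · simpa [sub_eq_zero] using ⟨ht0.ne', hyx⟩
    · exact (convex_convexHull ℝ _).add_smul_sub_mem hxi hyi ⟨ht0.le, min_le_left _ _⟩
  -- Around such a vertex inside `Ω` a small punctured ball contains no other vertex, yet both
  -- closed families meet it and together cover it. Its connectedness yields a forbidden second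
  -- meeting point.
  have hdisj : ¬(Ω ∩ (K₁ ∩ K₂)).Nonempty := by
    rintro ⟨x, hxΩ, hx1, hx2⟩
    have hFx : IsClosed (F \ {x}) := (hF.subset sdiff_subset).isClosed
    have hnhds : Ω ∩ (F \ {x})ᶜ ∈ 𝓝 x :=
      (M.isOpen_domain.inter hFx.isOpen_compl).mem_nhds ⟨hxΩ, fun h => h.2 rfl⟩
    obtain ⟨r, hr, hball⟩ := Metric.mem_nhds_iff.1 hnhds
    obtain ⟨y, ⟨hy, hyx⟩, hyK⟩ := isPreconnected_closed_iff.1 (isPreconnected_punctured_ball x r)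
      K₁ K₂ (M.isClosed_biUnion_element S) (M.isClosed_biUnion_element Sᶜ)
      (fun y hy => hcov (hball hy.1).1) (hmeet S x r hr hx1) (hmeet Sᶜ x r hr hx2)
    exact (hball hy).2 ⟨hKF hyK, hyx⟩
  have hint : ∀ (T : Set ι) (i : ι), i ∈ T → (Ω ∩ ⋃ i ∈ T, element M.vert i).Nonempty := by
    intro T i hi
    obtain ⟨y, hy⟩ := M.interior_subTriangle_nonempty hm (i, 0)
    have hy' := interior_mono (M.subTriangle_subset i 0) hy
    exact ⟨y, M.interior_element_subset i hy', mem_biUnion hi (interior_subset hy')⟩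
  exact hdisj (isPreconnected_closed_iff.1 hΩ K₁ K₂ (M.isClosed_biUnion_element S)
    (M.isClosed_biUnion_element Sᶜ) hcov (hint S i₀ hi₀) (hint Sᶜ k₀ hk₀))

/-! ### Boundary edges -/

omit [Fintype ι] in
-- At a point outside the interior some edge inequality fails to be strict. In coordinates of a
-- subtriangle containing the point, that inequality bounds `1 - α - β` times a positive area by
-- zero, so the point lies on the outer edge of this subtriangle, even when it is not the edge of
-- the inequality.
theorem mem_edge_of_notMem_interior (hm : m = 3 ∨ m = 4) {i : ι} {x : Plane}
    (hx : x ∈ element M.vert i) (hxi : x ∉ interior (element M.vert i)) :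
    ∃ k, x ∈ edge M.vert i k := by
  obtain ⟨j, hj⟩ : ∃ j, cross (M.vert i (j + 1) - M.vert i j) (x - M.vert i j) ≤ 0 := by
    by_contra! H
    refine hxi (mem_interior.2 ⟨⋂ j, {y | 0 < cross (M.vert i (j + 1) - M.vert i j)
      (y - M.vert i j)}, fun y hy => ?_, isOpen_iInter_of_finite fun j => ?_, mem_iInter.2 H⟩)
    · obtain ⟨k, hk⟩ := M.exists_mem_subTriangle_of_cross hm fun j => (mem_iInter.1 hy j).le
      exact M.subTriangle_subset i k hk
    · refine isOpen_lt continuous_const ?_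
      unfold cross
      fun_prop
  obtain ⟨k, hk⟩ := M.exists_mem_subTriangle hm hx
  obtain ⟨α, β, hα, hβ, hαβ, rfl⟩ := mem_triangle.1 hk
  refine ⟨k, ?_⟩
  have h1 := M.cross_vert_nonneg hm i j k
  have h2 := M.cross_vert_nonneg hm i j (k + 1)
  have h3 := M.area_pos hm (i, j)
  have e : cross (M.vert i (j + 1) - M.vert i j) (center M.vert i +
      (α • (M.vert i k - center M.vert i) + β • (M.vert i (k + 1) - center M.vert i))
        - M.vert i j) = (1 - α - β) * M.area (i, j)
        + α * cross (M.vert i (j + 1) - M.vert i j) (M.vert i k - M.vert i j)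
        + β * cross (M.vert i (j + 1) - M.vert i j) (M.vert i (k + 1) - M.vert i j) := by
    simp only [area, arm, cross, PiLp.sub_apply, PiLp.add_apply, PiLp.smul_apply, smul_eq_mul]
    ring
  rw [e] at hj
  have h4 : (1 - α - β) * M.area (i, j) ≤ 0 := by
    have := mul_nonneg hα h1
    have := mul_nonneg hβ h2
    linarith
  have h5 : α + β = 1 := by
    have := nonpos_of_mul_nonpos_left h4 h3
    linarith
  rw [edge, segment_eq_image']
  refine ⟨β, ⟨hβ, by linarith⟩, ?_⟩
  obtain rfl : α = 1 - β := by linarith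
  module

omit [Fintype ι] in
-- Near a point of the edge other than its endpoints, only the inequality of the edge itself is
-- active. The neighbors traverse the edge in opposite directions, so their two half-neighborhoods
-- fill a full one.
theorem mem_interior_of_mem_two_edges (hm : m = 3 ∨ m = 4) {p q : ι × Fin m} (hpq : p ≠ q)
    (h : edge M.vert q.1 q.2 = edge M.vert p.1 p.2) {x : Plane} (hx : x ∈ edge M.vert p.1 p.2)
    (h0 : x ≠ M.vert p.1 p.2) (h1 : x ≠ M.vert p.1 (p.2 + 1)) : x ∈ Ω := by
  obtain ⟨-, e1, e2⟩ := M.opposite_of_edge_eq hm hpq h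
  have pos : ∀ q : ι × Fin m, x ∈ edge M.vert q.1 q.2 → x ≠ M.vert q.1 q.2 →
      x ≠ M.vert q.1 (q.2 + 1) → 0 < cross (M.arm q.1 q.2) (x - center M.vert q.1) ∧
        0 < cross (x - center M.vert q.1) (M.arm q.1 (q.2 + 1)) := by
    intro q hx h0 h1
    have hA := M.area_pos hm q
    rw [edge, segment_eq_image'] at hx
    obtain ⟨t, ⟨ht0, ht1⟩, rfl⟩ := hx
    have ht0' : 0 < t := ht0.lt_of_ne fun e => h0 (by simp [← e])
    have ht1' : t < 1 := ht1.lt_of_ne fun e => h1 (by simp [e])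
    have a1 : cross (M.arm q.1 q.2) (M.vert q.1 q.2 + t • (M.vert q.1 (q.2 + 1) - M.vert q.1 q.2)
        - center M.vert q.1) = t * M.area q := by
      simp only [area, arm, cross, PiLp.sub_apply, PiLp.add_apply, PiLp.smul_apply, smul_eq_mul]
      ring
    have a2 : cross (M.vert q.1 q.2 + t • (M.vert q.1 (q.2 + 1) - M.vert q.1 q.2)
        - center M.vert q.1) (M.arm q.1 (q.2 + 1)) = (1 - t) * M.area q := by
      simp only [area, arm, cross, PiLp.sub_apply, PiLp.add_apply, PiLp.smul_apply, smul_eq_mul]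
      ring
    rw [a1, a2]
    exact ⟨mul_pos ht0' hA, mul_pos (by linarith) hA⟩
  have c1 : ∀ (P c : Plane), Continuous fun y : Plane => cross P (y - c) := fun P c => by
    unfold cross; fun_prop
  have c2 : ∀ (P c : Plane), Continuous fun y : Plane => cross (y - c) P := fun P c => by
    unfold cross; fun_prop
  have near : ∀ q : ι × Fin m, x ∈ edge M.vert q.1 q.2 → x ≠ M.vert q.1 q.2 →
      x ≠ M.vert q.1 (q.2 + 1) → ∀ᶠ y in 𝓝 x,
        0 ≤ cross (M.vert q.1 (q.2 + 1) - M.vert q.1 q.2) (y - M.vert q.1 q.2) →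
          y ∈ element M.vert q.1 := by
    intro q hx h0 h1
    obtain ⟨k1, k2⟩ := pos q hx h0 h1
    filter_upwards [(c1 _ _).continuousAt.eventually (lt_mem_nhds k1),
      (c2 _ _).continuousAt.eventually (lt_mem_nhds k2)] with y y1 y2 y3
    exact M.subTriangle_subset q.1 q.2 ((M.mem_subTriangle_iff hm).2 ⟨y1.le, y2.le, y3⟩)
  rw [← M.cover, mem_interior_iff_mem_nhds]
  filter_upwards [near p hx h0 h1, near q (h ▸ hx) (e1 ▸ h1) (e2 ▸ h0)] with y y1 y2
  rcases le_total 0 (cross (M.vert p.1 (p.2 + 1) - M.vert p.1 p.2) (y - M.vert p.1 p.2)) with k | k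
  · exact mem_iUnion.2 ⟨_, y1 k⟩
  · refine mem_iUnion.2 ⟨_, y2 ?_⟩
    rw [e1, e2]
    have e : cross (M.vert p.1 p.2 - M.vert p.1 (p.2 + 1)) (y - M.vert p.1 (p.2 + 1))
        = -cross (M.vert p.1 (p.2 + 1) - M.vert p.1 p.2) (y - M.vert p.1 p.2) := by
      simp only [cross, PiLp.sub_apply]; ring
    rw [e]; linarith

/-- A frontier point of the domain is a vertex or lies on an edge of a single element. -/
theorem mem_boundary_edge (hm : m = 3 ∨ m = 4) {x : Plane} (hx : x ∈ frontier Ω)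
    (hv : ∀ p : ι × Fin m, x ≠ M.vert p.1 p.2) :
    ∃ p : ι × Fin m, (∀ q : ι × Fin m, edge M.vert q.1 q.2 = edge M.vert p.1 p.2 → q = p) ∧
      x ∈ edge M.vert p.1 p.2 := by
  have hxΩ : x ∉ Ω := by
    have := hx.2
    rwa [M.isOpen_domain.interior_eq] at this
  have hcl : x ∈ ⋃ i, element M.vert i :=
    closure_minimal M.domain_subset (isClosed_iUnion_of_finite fun i =>
      (M.isCompact_element i).isClosed) hx.1
  obtain ⟨i, hi⟩ := mem_iUnion.1 hcl
  obtain ⟨k, hk⟩ := M.mem_edge_of_notMem_interior hm hi fun h =>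
    hxΩ (M.interior_element_subset i h)
  refine ⟨(i, k), fun q hq => ?_, hk⟩
  by_contra hne
  exact hxΩ (M.mem_interior_of_mem_two_edges hm (Ne.symm hne) hq hk (hv (i, k)) (hv (i, k + 1)))

/-- A field that vanishes on a part of the boundary of positive length has two zeros on an edge
of a single element. -/
theorem exists_boundary_edge (hm : m = 3 ∨ m = 4) {ΓD : Set Plane} (hΓD : ΓD ⊆ frontier Ω)
    (hpos : 0 < Measure.hausdorffMeasure 1 ΓD) {w : Plane → Plane} (hΓm : MeasurableSet ΓD)
    (hw : ∀ᵐ x ∂((Measure.hausdorffMeasure 1).restrict ΓD), w x = 0) :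
    ∃ p : ι × Fin m, (∀ q : ι × Fin m, edge M.vert q.1 q.2 = edge M.vert p.1 p.2 → q = p) ∧
      ∃ a ∈ edge M.vert p.1 p.2, ∃ b ∈ edge M.vert p.1 p.2, a ≠ b ∧ w a = 0 ∧ w b = 0 := by
  by_contra! H
  have hna : NullSingletonClass (Measure.hausdorffMeasure 1 : Measure Plane) :=
    Measure.nullSingletonClass_hausdorff Plane one_pos
  let B : Set (ι × Fin m) :=
    {p | ∀ q : ι × Fin m, edge M.vert q.1 q.2 = edge M.vert p.1 p.2 → q = p}
  let F : Set Plane := range fun p : ι × Fin m => M.vert p.1 p.2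
  -- If every boundary edge had at most one zero of `w`, then `ΓD` would consist of a null set,
  -- finitely many vertices and finitely many zeros, contradicting its positive length.
  have hsub : ΓD ⊆ {x | x ∈ ΓD ∧ w x ≠ 0} ∪
      (F ∪ ⋃ p ∈ B, (edge M.vert p.1 p.2 ∩ {x | w x = 0})) := by
    intro x hx
    by_cases hwx : w x = 0
    · refine Or.inr ?_
      by_cases hxF : x ∈ F
      · exact Or.inl hxF
      · obtain ⟨p, hp, hxp⟩ := M.mem_boundary_edge hm (hΓD hx)
          fun p e => hxF ⟨p, e.symm⟩
        exact Or.inr (mem_biUnion (show p ∈ B from hp) ⟨hxp, hwx⟩)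
    · exact Or.inl ⟨hx, hwx⟩
  have h1 : (Measure.hausdorffMeasure 1 : Measure Plane) {x | x ∈ ΓD ∧ w x ≠ 0} = 0 := by
    have := ae_iff.1 ((ae_restrict_iff' hΓm).1 hw)
    simpa using this
  have h2 : (F ∪ ⋃ p ∈ B, (edge M.vert p.1 p.2 ∩ {x | w x = 0})).Countable := by
    refine (finite_range _).countable.union ((to_countable B).biUnion fun p hp => ?_)
    refine Set.Subsingleton.countable fun a ha b hb => ?_
    by_contra hab
    exact H p hp a ha.1 b hb.1 hab ha.2 hb.2
  exact hpos.ne' (measure_mono_null hsub (measure_union_null h1 (h2.measure_zero _)))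

end Mesh

/-! ### Piecewise affine fields and the exclusion of the checkerboard mode -/

namespace Mesh

variable {m : ℕ} [NeZero m] {ι : Type} {Ω : Set Plane} (M : Mesh m ι Ω)

/-- The field `w` is affine with gradient `G p` on the `p`-th subtriangle, and its value at the
center of an element is the mean of its values at the vertices. -/
structure IsPiecewiseAffine (w : Plane → Plane) (G : ι × Fin m → Plane →ₗ[ℝ] Plane) : Prop where
  eq : ∀ p : ι × Fin m, ∀ x ∈ subTriangle M.vert p.1 p.2,
    w x = w (center M.vert p.1) + G p (x - center M.vert p.1)
  mean : ∀ i, ∑ j, (w (M.vert i j) - w (center M.vert i)) = 0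

theorem center_mem_subTriangle (p : ι × Fin m) :
    center M.vert p.1 ∈ subTriangle M.vert p.1 p.2 := subset_convexHull ℝ _ (by simp)

theorem vert_mem_subTriangle (p : ι × Fin m) :
    M.vert p.1 p.2 ∈ subTriangle M.vert p.1 p.2 := subset_convexHull ℝ _ (by simp)

theorem vert_add_one_mem_subTriangle (p : ι × Fin m) :
    M.vert p.1 (p.2 + 1) ∈ subTriangle M.vert p.1 p.2 := subset_convexHull ℝ _ (by simp)

theorem edge_subset_subTriangle (p : ι × Fin m) :
    edge M.vert p.1 p.2 ⊆ subTriangle M.vert p.1 p.2 :=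
  (convex_convexHull ℝ _).segment_subset (M.vert_mem_subTriangle p)
    (M.vert_add_one_mem_subTriangle p)

/-- This description covers both kinds of mesh. On triangles the mean condition is automatic, as
affine maps commute with means; on quadrilaterals it is part of the definition. -/
theorem exists_isPiecewiseAffine (hm : m = 3 ∨ m = 4) {w : Plane → Plane}
    (hw : M.IsElementField w) : ∃ A : ι × Fin m → Plane →ᵃ[ℝ] Plane,
      (∀ p, EqOn w (A p) (subTriangle M.vert p.1 p.2)) ∧
        M.IsPiecewiseAffine w fun p => (A p).linear := by
  have main : ∃ A : ι × Fin m → Plane →ᵃ[ℝ] Plane,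
      (∀ p, EqOn w (A p) (subTriangle M.vert p.1 p.2)) ∧
        ∀ i, ∑ j, (w (M.vert i j) - w (center M.vert i)) = 0 := by
    rcases hm with rfl | rfl
    · choose A hA using hw.triangle rfl
      refine ⟨fun p => A p.1, fun p => (hA p.1).mono (M.subTriangle_subset _ _), fun i => ?_⟩
      have e : ∀ j, w (M.vert i j) - w (center M.vert i) = (A i).linear (M.arm i j) := fun j => by
        rw [hA i (M.vert_mem i j), hA i (M.center_mem i)]
        exact ((A i).linearMap_vsub _ _).symm
      simp only [e]
      rw [← map_sum, M.sum_arm, map_zero]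
    · choose A hA using fun i => (hw.quadrilateral rfl i).1
      refine ⟨fun p => A p.1 p.2, fun p => hA p.1 p.2, fun i => ?_⟩
      rw [Finset.sum_sub_distrib, Finset.sum_const, (hw.quadrilateral rfl i).2, Finset.card_univ,
        Fintype.card_fin, ← Nat.cast_smul_eq_nsmul ℝ, smul_smul]
      norm_num
  obtain ⟨A, hA, hmean⟩ := main
  refine ⟨A, hA, ⟨fun p x hx => ?_, hmean⟩⟩
  rw [hA p hx, hA p (M.center_mem_subTriangle p)]
  have := (A p).linearMap_vsub x (center M.vert p.1)
  simp only [vsub_eq_sub] at this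
  rw [this, add_sub_cancel]

variable {M}

namespace IsPiecewiseAffine

variable {w : Plane → Plane} {G : ι × Fin m → Plane →ₗ[ℝ] Plane}

theorem apply_sub (h : M.IsPiecewiseAffine w G) (p : ι × Fin m) {x y : Plane}
    (hx : x ∈ subTriangle M.vert p.1 p.2) (hy : y ∈ subTriangle M.vert p.1 p.2) :
    G p (x - y) = w x - w y := by
  rw [h.eq p x hx, h.eq p y hy, ← sub_sub_sub_cancel_right x y (center M.vert p.1), map_sub]
  abel

theorem area_smul_symGrad (h : M.IsPiecewiseAffine w G) (i : ι) (j : Fin m) :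
    M.area (i, j) • symGrad (G (i, j)) = crossStrain (M.arm i j) (M.arm i (j + 1))
      (w (M.vert i j) - w (center M.vert i)) (w (M.vert i (j + 1)) - w (center M.vert i)) := by
  rw [area, cross_smul_symGrad]
  congr 1
  · exact h.apply_sub (i, j) (M.vert_mem_subTriangle _) (M.center_mem_subTriangle _)
  · exact h.apply_sub (i, j) (M.vert_add_one_mem_subTriangle (i, j)) (M.center_mem_subTriangle _)

end IsPiecewiseAffine

variable [Fintype ι]

theorem sum_eq_sum_of_sameEdge {a b : ι × Fin m → ℝ}
    (h : ∀ p, ∑ q ∈ M.sameEdge p, a q = ∑ q ∈ M.sameEdge p, b q) : ∑ p, a p = ∑ p, b p := by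
  classical
  have hmaps : ∀ p ∈ (Finset.univ : Finset (ι × Fin m)), edge M.vert p.1 p.2 ∈
      Finset.univ.image fun p : ι × Fin m => edge M.vert p.1 p.2 :=
    fun p hp => Finset.mem_image_of_mem _ hp
  rw [← Finset.sum_fiberwise_of_maps_to hmaps, ← Finset.sum_fiberwise_of_maps_to hmaps]
  refine Finset.sum_congr rfl fun T hT => ?_
  obtain ⟨p, -, rfl⟩ := Finset.mem_image.1 hT
  convert h p using 2
  all_goals
  · ext q
    simp [mem_sameEdge]

theorem sign_eq_neg_sign {a b x y : ℝ} (ha : 0 < a) (hb : 0 < b) (h : a * x + b * y = 0) :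
    Real.sign y = -Real.sign x := by
  rcases lt_trichotomy x 0 with hx | rfl | hx
  · have : 0 < y := by nlinarith [mul_neg_of_pos_of_neg ha hx]
    rw [Real.sign_of_pos this, Real.sign_of_neg hx, neg_neg]
  · have : y = 0 := by simpa [hb.ne'] using h
    rw [this, Real.sign_zero, neg_zero]
  · have : y < 0 := by nlinarith [mul_pos ha hx]
    rw [Real.sign_of_neg this, Real.sign_of_pos hx]

theorem sign_mul_eq_abs (x : ℝ) : Real.sign x * x = |x| := by
  rcases lt_trichotomy x 0 with hx | rfl | hx
  · rw [Real.sign_of_neg hx, abs_of_neg hx]; ring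
  · simp
  · rw [Real.sign_of_pos hx, abs_of_pos hx]; ring

/-- Smoothing to the vertex cells does not annihilate the edge averages of the strain of a finite
element field. -/
theorem edge_average_eq_zero (hm : m = 3 ∨ m = 4) {w : Plane → Plane}
    {G : ι × Fin m → Plane →ₗ[ℝ] Plane} (h : M.IsPiecewiseAffine w G) {E : ι × Fin m → Voigt}
    (hE : ∀ p, ∀ q ∈ M.sameEdge p, E q = E p)
    (hsum : ∀ p, ∑ q ∈ M.sameEdge p, M.area q • symGrad (G q)
      = (∑ q ∈ M.sameEdge p, M.area q) • E p)
    (hvert : ∀ i j, M.area (i, j) • E (i, j) + M.area (i, j + 1) • E (i, j + 1) = 0) :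
    ∀ p, E p = 0 := by
  rcases hm with rfl | rfl
  · rintro ⟨i, j⟩
    have h0 := hvert i j
    have h1 := hvert i (j + 1)
    have h2 := hvert i (j + 2)
    rw [Fin.add_one_add_one] at h1
    rw [Fin.add_two_add_one, Fin.add_three_three] at h2
    -- Around an odd cycle the alternating combination of the three relations leaves a single term,
    -- doubled.
    have h3 : (2 * M.area (i, j)) • E (i, j) = 0 := by
      linear_combination (norm := module) h0 - h1 + h2
    have hA := M.area_pos (Or.inl rfl) (i, j)
    exact (smul_eq_zero.1 h3).resolve_left (by positivity)
  · intro p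
    ext k
    -- The sign pattern serves as a test function: it alternates around each element and is constant
    -- on each edge cell.
    let s : ι × Fin 4 → ℝ := fun p => Real.sign (E p k)
    have hs : ∀ i j, s (i, j + 1) = -s (i, j) := fun i j => by
      have := congrArg (fun e : Voigt => e k) (hvert i j)
      simp only [PiLp.add_apply, PiLp.smul_apply, smul_eq_mul, PiLp.zero_apply] at this
      exact sign_eq_neg_sign (M.area_pos (Or.inr rfl) _) (M.area_pos (Or.inr rfl) _) this
    -- Grouped by elements, the alternating signs produce the vanishing alternating sum of
    -- area-weighted strains.
    have h1 : ∑ p, s p * (M.area p • symGrad (G p)) k = 0 := by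
      rw [Fintype.sum_prod_type]
      refine Finset.sum_eq_zero fun i _ => ?_
      have hP := M.sum_arm i
      have hp := h.mean i
      rw [Fin.sum_four_cyclic _ 0] at hP hp ⊢
      have e1 := hs i 0
      have e2 := hs i (0 + 1)
      have e3 := hs i (0 + 2)
      have a0 := h.area_smul_symGrad i 0
      have a1 := h.area_smul_symGrad i (0 + 1)
      have a2 := h.area_smul_symGrad i (0 + 2)
      have a3 := h.area_smul_symGrad i (0 + 3)
      rw [Fin.add_one_add_one] at e2 a1
      rw [Fin.add_two_add_one] at e3 a2
      rw [Fin.add_three_add_one_four] at a3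
      have key := congrArg (fun e : Voigt => e k) (crossStrain_alternating_sum hP hp)
      simp only [PiLp.add_apply, PiLp.sub_apply, PiLp.zero_apply] at key
      rw [a0, a1, a2, a3, e3, e2, e1]
      linear_combination (s (i, 0)) * key
    -- Grouped by edges, the sign is constant and the strains may be replaced by their average `E`,
    -- so sign and value combine to an absolute value.
    have h2 : ∑ p, s p * (M.area p • symGrad (G p)) k = ∑ p, M.area p * |E p k| := by
      refine sum_eq_sum_of_sameEdge (M := M) fun p => ?_
      have e1 : ∀ q ∈ M.sameEdge p, s q = s p := fun q hq => by simp only [s, hE p q hq]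
      have e2 := congrArg (fun e : Voigt => s p * e k) (hsum p)
      simp only [WithLp.ofLp_sum, Finset.sum_apply, PiLp.smul_apply, smul_eq_mul] at e2
      rw [Finset.mul_sum] at e2
      have e3 : ∑ q ∈ M.sameEdge p, s q * (M.area q • symGrad (G q)) k
          = ∑ q ∈ M.sameEdge p, s p * (M.area q * symGrad (G q) k) :=
        Finset.sum_congr rfl fun q hq => by rw [e1 q hq, PiLp.smul_apply, smul_eq_mul]
      have e4 : ∑ q ∈ M.sameEdge p, M.area q * |E q k| = ∑ q ∈ M.sameEdge p, M.area q * |E p k| :=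
        Finset.sum_congr rfl fun q hq => by rw [hE p q hq]
      rw [e3, e2, e4, ← Finset.sum_mul, ← sign_mul_eq_abs]
      ring
    rw [h2] at h1
    have h3 := (Finset.sum_eq_zero_iff_of_nonneg fun p _ =>
      mul_nonneg (M.area_pos (Or.inr rfl) p).le (abs_nonneg (E p k))).1 h1 p (Finset.mem_univ _)
    exact abs_eq_zero.1 ((mul_eq_zero.1 h3).resolve_left (M.area_pos (Or.inr rfl) p).ne')

/-! ### Finite element fields with vanishing edge averages of the strain -/

theorem area_smul_add_area_smul (hm : m = 3 ∨ m = 4) {e : ι × Fin m → Voigt}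
    (h : ∀ p, ∑ q ∈ M.sameEdge p, M.area q • e q = 0) {p q : ι × Fin m} (hpq : p ≠ q)
    (hq : edge M.vert q.1 q.2 = edge M.vert p.1 p.2) :
    M.area p • e p + M.area q • e q = 0 := by
  classical
  have hs : M.sameEdge p = {p, q} := by
    ext q'
    rw [mem_sameEdge, Finset.mem_insert, Finset.mem_singleton]
    constructor
    · intro hq'
      by_cases e : p = q'
      · exact Or.inl e.symm
      · exact Or.inr (M.eq_of_edge_eq hm e hpq hq' hq)
    · rintro (rfl | rfl)
      exacts [rfl, hq]
  rw [← h p, hs, Finset.sum_pair hpq]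

theorem eq_zero_of_boundary (hm : m = 3 ∨ m = 4) {e : ι × Fin m → Voigt}
    (h : ∀ p, ∑ q ∈ M.sameEdge p, M.area q • e q = 0) {p : ι × Fin m}
    (hp : ∀ q : ι × Fin m, edge M.vert q.1 q.2 = edge M.vert p.1 p.2 → q = p) : e p = 0 := by
  have hs : M.sameEdge p = {p} := by
    ext q
    rw [mem_sameEdge, Finset.mem_singleton]
    exact ⟨hp q, fun e => by rw [e]⟩
  have := h p
  rw [hs, Finset.sum_singleton] at this
  exact (smul_eq_zero.1 this).resolve_left (M.area_pos hm p).ne'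

/-- The edges are not stretched. -/
theorem dot_edge_eq_zero (hm : m = 3 ∨ m = 4) {w : Plane → Plane}
    {G : ι × Fin m → Plane →ₗ[ℝ] Plane} (h : M.IsPiecewiseAffine w G)
    (h0 : ∀ p, ∑ q ∈ M.sameEdge p, M.area q • symGrad (G q) = 0) (i : ι) (j : Fin m) :
    (w (M.vert i (j + 1)) - w (M.vert i j)) 0 * (M.vert i (j + 1) - M.vert i j) 0
      + (w (M.vert i (j + 1)) - w (M.vert i j)) 1 * (M.vert i (j + 1) - M.vert i j) 1 = 0 := by
  have hst : ∀ q : ι × Fin m, stretch (symGrad (G q)) (M.vert q.1 (q.2 + 1) - M.vert q.1 q.2)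
      = (w (M.vert q.1 (q.2 + 1)) - w (M.vert q.1 q.2)) 0
          * (M.vert q.1 (q.2 + 1) - M.vert q.1 q.2) 0
        + (w (M.vert q.1 (q.2 + 1)) - w (M.vert q.1 q.2)) 1
          * (M.vert q.1 (q.2 + 1) - M.vert q.1 q.2) 1 := fun q => by
    rw [stretch_symGrad, h.apply_sub q (M.vert_add_one_mem_subTriangle q)
      (M.vert_mem_subTriangle q)]
  by_cases hp : ∀ q : ι × Fin m, edge M.vert q.1 q.2 = edge M.vert i j → q = (i, j)
  · have := hst (i, j)
    rw [eq_zero_of_boundary (e := fun q => symGrad (G q)) hm h0 (p := (i, j)) hp] at this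
    simpa [stretch] using this.symm
  · push Not at hp
    obtain ⟨q, hq, hne⟩ := hp
    obtain ⟨-, e1, e2⟩ := M.opposite_of_edge_eq (p := (i, j)) hm (Ne.symm hne) hq
    have hs := area_smul_add_area_smul (e := fun q => symGrad (G q)) hm h0 (Ne.symm hne) hq
    have s1 := hst (i, j)
    have s2 := hst q
    rw [e1, e2] at s2
    simp only at s1 s2
    -- `stretch` is linear in the strain and even in the vector, so the vanishing average passes to
    -- the elongations although the neighbors orient the edge oppositely. Both elongations equal the
    -- same expression in the endpoint values, so that expression is zero.
    have hs' : M.area (i, j) * stretch (symGrad (G (i, j))) (M.vert i (j + 1) - M.vert i j)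
        + M.area q * stretch (symGrad (G q)) (M.vert i j - M.vert i (j + 1)) = 0 := by
      have k := fun c : Fin 3 => congrArg (fun e : Voigt => e c) hs
      simp only [PiLp.add_apply, PiLp.smul_apply, smul_eq_mul, PiLp.zero_apply] at k
      simp only [stretch, PiLp.sub_apply]
      linear_combination (M.vert i (j + 1) 0 - M.vert i j 0) ^ 2 * k 0
        + (M.vert i (j + 1) 1 - M.vert i j 1) ^ 2 * k 1
        + (M.vert i (j + 1) 0 - M.vert i j 0) * (M.vert i (j + 1) 1 - M.vert i j 1) * k 2
    rw [s1, s2] at hs'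
    have hA := add_pos (M.area_pos hm (i, j)) (M.area_pos hm q)
    refine (mul_eq_zero.1 (?_ : (M.area (i, j) + M.area q) * _ = 0)).resolve_left hA.ne'
    simp only [PiLp.sub_apply] at hs' ⊢
    linear_combination hs'

/-- The affine field on this subtriangle is an infinitesimal rigid motion with two zeros, so the
center value is zero too. The mean condition then settles the third vertex of a triangle. For a
quadrilateral it says that the two remaining values are opposite, and the unstretched edges
determine them. -/
theorem vert_eq_zero_of_edge (hm : m = 3 ∨ m = 4) {w : Plane → Plane}
    {G : ι × Fin m → Plane →ₗ[ℝ] Plane} (h : M.IsPiecewiseAffine w G)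
    (h0 : ∀ p, ∑ q ∈ M.sameEdge p, M.area q • symGrad (G q) = 0) {i : ι} {j : Fin m}
    (he : symGrad (G (i, j)) = 0) (w0 : w (M.vert i j) = 0) (w1 : w (M.vert i (j + 1)) = 0) :
    ∀ k, w (M.vert i k) = 0 := by
  have hG : G (i, j) = 0 := by
    refine eq_zero_of_symGrad_eq_zero he (sub_ne_zero.2 (M.vert_ne i j).symm) ?_
    rw [h.apply_sub (i, j) (M.vert_add_one_mem_subTriangle (i, j)) (M.vert_mem_subTriangle _), w0,
      w1, sub_zero]
  have hc : w (center M.vert i) = 0 := by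
    have := h.eq (i, j) _ (M.vert_mem_subTriangle (i, j))
    rw [hG, LinearMap.zero_apply, add_zero] at this
    exact this.symm.trans w0
  have hmean := h.mean i
  simp only [hc, sub_zero] at hmean
  rcases hm with rfl | rfl
  · rw [Fin.sum_three_cyclic _ j, w0, w1, add_zero, zero_add] at hmean
    intro k
    rcases Fin.three_cases j k with rfl | rfl | rfl
    exacts [w0, w1, hmean]
  · rw [Fin.sum_four_cyclic _ j, w0, w1, add_zero, zero_add] at hmean
    have d1 := dot_edge_eq_zero (Or.inr rfl) h h0 i (j + 1)
    have d2 := dot_edge_eq_zero (Or.inr rfl) h h0 i (j + 2)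
    have hcv := M.convex i (j + 1)
    have e3 : j + 1 + 2 = j + 3 := by
      rw [← Fin.add_one_add_one, Fin.add_one_add_one j, Fin.add_two_add_one]
    rw [Fin.add_one_add_one] at d1 hcv
    rw [e3] at hcv
    rw [Fin.add_two_add_one] at d2
    have w3 : w (M.vert i (j + 3)) = -w (M.vert i (j + 2)) := eq_neg_of_add_eq_zero_right hmean
    rw [w1] at d1
    rw [w3] at d2
    simp only [PiLp.sub_apply, PiLp.neg_apply, sub_zero] at d1 d2
    simp only [cross, PiLp.sub_apply] at hcv
    -- The value is orthogonal to the edges from `j + 1` to `j + 2` and from `j + 2` to `j + 3`,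
    -- which are independent by strict convexity. The factor `1 / 2` below compensates for the
    -- displacement difference `-2 w` along the second edge.
    have w2 : w (M.vert i (j + 2)) = 0 := by
      ext k
      refine (mul_eq_zero.1 (?_ : _ * _ = (0 : ℝ))).resolve_left hcv.ne'
      fin_cases k
      · simp only [Fin.zero_eta]
        linear_combination (M.vert i (j + 3) 1 - M.vert i (j + 2) 1) * d1
          + (1 / 2) * (M.vert i (j + 2) 1 - M.vert i (j + 1) 1) * d2
      · simp only [Fin.mk_one]
        linear_combination -(M.vert i (j + 3) 0 - M.vert i (j + 2) 0) * d1
          - (1 / 2) * (M.vert i (j + 2) 0 - M.vert i (j + 1) 0) * d2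
    rw [w2, neg_zero] at w3
    intro k
    rcases Fin.four_cases j k with rfl | rfl | rfl | rfl
    exacts [w0, w1, w2, w3]

omit [Fintype ι] in
theorem gradient_eq_zero_of_vert (hm : m = 3 ∨ m = 4) {w : Plane → Plane}
    {G : ι × Fin m → Plane →ₗ[ℝ] Plane} (h : M.IsPiecewiseAffine w G) {p : ι × Fin m}
    (hw : ∀ k, w (M.vert p.1 k) = 0) : G p = 0 ∧ ∀ x ∈ subTriangle M.vert p.1 p.2, w x = 0 := by
  have hc : w (center M.vert p.1) = 0 := by
    have := h.mean p.1
    simp only [hw, zero_sub, Finset.sum_const, Finset.card_univ, Fintype.card_fin] at this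
    rw [← Nat.cast_smul_eq_nsmul ℝ] at this
    exact neg_eq_zero.1 ((smul_eq_zero.1 this).resolve_left (Nat.cast_ne_zero.2 (NeZero.ne m)))
  have h0 : G p (M.arm p.1 p.2) = 0 := by
    rw [arm, h.apply_sub p (M.vert_mem_subTriangle p) (M.center_mem_subTriangle p), hw, hc, sub_zero]
  have h1 : G p (M.arm p.1 (p.2 + 1)) = 0 := by
    rw [arm, h.apply_sub p (M.vert_add_one_mem_subTriangle p) (M.center_mem_subTriangle p), hw, hc,
      sub_zero]
  have hG : G p = 0 := by
    ext1 z
    rw [eq_smul_add_smul (M.area_pos hm p).ne' z, map_add, map_smul, map_smul, h0, h1]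
    simp
  refine ⟨hG, fun x hx => ?_⟩
  rw [h.eq p x hx, hG, hc, LinearMap.zero_apply, add_zero]

/-- A finite element field with vanishing edge averages of the strain that vanishes on a part of
the boundary of positive length is zero. -/
theorem gradient_eq_zero (hm : m = 3 ∨ m = 4) (hΩ : IsPreconnected Ω) {ΓD : Set Plane}
    (hΓD : ΓD ⊆ frontier Ω) (hΓm : MeasurableSet ΓD)
    (hpos : 0 < Measure.hausdorffMeasure 1 ΓD) {w : Plane → Plane}
    (hw : ∀ᵐ x ∂((Measure.hausdorffMeasure 1).restrict ΓD), w x = 0)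
    {G : ι × Fin m → Plane →ₗ[ℝ] Plane} (h : M.IsPiecewiseAffine w G)
    (h0 : ∀ p, ∑ q ∈ M.sameEdge p, M.area q • symGrad (G q) = 0) :
    ∀ p, G p = 0 ∧ ∀ x ∈ subTriangle M.vert p.1 p.2, w x = 0 := by
  obtain ⟨p, hp, a, ha, b, hb, hab, wa, wb⟩ := M.exists_boundary_edge hm hΓD hpos hΓm hw
  have hsub := M.edge_subset_subTriangle p
  have ep : symGrad (G p) = 0 := eq_zero_of_boundary (e := fun q => symGrad (G q)) hm h0 hp
  have Gp : G p = 0 := by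
    refine eq_zero_of_symGrad_eq_zero ep (sub_ne_zero.2 hab) ?_
    rw [h.apply_sub p (hsub ha) (hsub hb), wa, wb, sub_zero]
  have wp : ∀ x ∈ subTriangle M.vert p.1 p.2, w x = 0 := fun x hx => by
    have := h.apply_sub p hx (hsub ha)
    rw [Gp, LinearMap.zero_apply, wa, sub_zero] at this
    exact this.symm
  -- On an element with zero vertex values the strain vanishes, so the vanishing edge average makes
  -- it vanish on the neighboring subtriangle too. The common endpoints are zeros, and the neighbor
  -- follows.
  have hall : {i | ∀ k, w (M.vert i k) = 0} = univ := by
    refine M.edge_connected hm hΩ _ ⟨p.1, vert_eq_zero_of_edge hm h h0 (j := p.2) ep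
      (wp _ (M.vert_mem_subTriangle p)) (wp _ (M.vert_add_one_mem_subTriangle p))⟩ ?_
    intro p q hpq hq hZ
    obtain ⟨-, e1, e2⟩ := M.opposite_of_edge_eq hm hpq hq
    have Gz : symGrad (G p) = 0 := by
      rw [(gradient_eq_zero_of_vert hm h hZ).1]
      ext k
      fin_cases k <;> simp [symGrad]
    have hs := area_smul_add_area_smul (e := fun q => symGrad (G q)) hm h0 hpq hq
    simp only [Gz, smul_zero, zero_add] at hs
    exact vert_eq_zero_of_edge hm h h0 (j := q.2)
      ((smul_eq_zero.1 hs).resolve_left (M.area_pos hm q).ne') (e1 ▸ hZ _) (e2 ▸ hZ _)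
  intro p
  have hp : p.1 ∈ {i | ∀ k, w (M.vert i k) = 0} := hall ▸ mem_univ _
  exact gradient_eq_zero_of_vert hm h hp

end Mesh

/-! ### The main theorem -/

section Operators

variable {Ω : Set Plane}

/-- The strain operator `B` as a linear map. -/
def strainₗ : H1 Ω →ₗ[ℝ] StrainL2 Ω where
  toFun := strain
  map_add' U U' := by
    have h : ∀ j, H1.partial (U + U') j = H1.partial U j + H1.partial U' j := fun _ => rfl
    have hB : ∀ (L : Plane →L[ℝ] Voigt) (a b : DispL2 Ω),
        L.compLp (a + b) = L.compLp a + L.compLp b := fun L a b => map_add (L.compLpL 2 _) a b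
    unfold strain
    rw [h, h]
    erw [hB, hB]
    abel
  map_smul' c U := by
    have h : ∀ j, H1.partial (c • U) j = c • H1.partial U j := fun _ => rfl
    have hB : ∀ (L : Plane →L[ℝ] Voigt) (a : DispL2 Ω),
        L.compLp (c • a) = c • L.compLp a := fun L a => map_smul (L.compLpL 2 _) c a
    unfold strain
    rw [h, h]
    erw [hB, hB]
    exact (smul_add c _ _).symm

/-- The application of a matrix to a field as a linear map. -/
def matMulₗ (D : Matrix (Fin 3) (Fin 3) ℝ) : StrainL2 Ω →ₗ[ℝ] StrainL2 Ω :=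
  ((Matrix.toEuclideanCLM (𝕜 := ℝ) D).compLpL 2 (volume.restrict Ω)).toLinearMap

theorem coeFn_matMul (D : Matrix (Fin 3) (Fin 3) ℝ) (ε : StrainL2 Ω) :
    ∀ᵐ x ∂(volume.restrict Ω), matMul D ε x = Matrix.toEuclideanCLM (𝕜 := ℝ) D (ε x) :=
  ContinuousLinearMap.coeFn_compLp _ ε

theorem matMul_mem_piecewiseConst (D : Matrix (Fin 3) (Fin 3) ℝ) {S : Subdivision}
    {ε : StrainL2 Ω} (h : ε ∈ piecewiseConst Ω S) : matMul D ε ∈ piecewiseConst Ω S := by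
  intro T hT
  obtain ⟨c, hc⟩ := h T hT
  exact ⟨_, by filter_upwards [hc, coeFn_matMul D ε] with x h1 h2 hx; rw [h2, h1 hx]⟩

theorem inner_toEuclideanCLM_pos {D : Matrix (Fin 3) (Fin 3) ℝ} (hD : D.PosDef) {v : Voigt}
    (hv : v ≠ 0) : 0 < inner ℝ (Matrix.toEuclideanCLM (𝕜 := ℝ) D v) v := by
  have h : v.ofLp ≠ 0 := fun h => hv (by ext k; exact congrFun h k)
  have := hD.dotProduct_mulVec_pos h
  rw [EuclideanSpace.inner_eq_star_dotProduct]
  simpa using this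

/-- The integrand is nonnegative almost everywhere and positive wherever the field is nonzero, so no
uniform coercivity constant is required. -/
theorem eq_zero_of_inner_matMul {D : Matrix (Fin 3) (Fin 3) ℝ} (hD : D.PosDef) {ε : StrainL2 Ω}
    (h : inner ℝ (matMul D ε) ε = 0) : ε = 0 := by
  have hnn : 0 ≤ᵐ[volume.restrict Ω] fun x => (inner ℝ (matMul D ε x) (ε x) : ℝ) := by
    filter_upwards [coeFn_matMul D ε] with x hx
    rw [Pi.zero_apply, hx]
    by_cases h0 : ε x = 0
    · simp [h0]
    · exact (inner_toEuclideanCLM_pos hD h0).le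
  rw [L2.inner_def, integral_eq_zero_iff_of_nonneg_ae hnn (L2.integrable_inner _ _)] at h
  refine (Lp.eq_zero_iff_ae_eq_zero).2 ?_
  filter_upwards [h, coeFn_matMul D ε] with x hx hx'
  by_contra h0
  rw [Pi.zero_apply, hx'] at hx
  exact (inner_toEuclideanCLM_pos hD h0).ne' hx

end Operators

namespace Mesh

variable {m : ℕ} [NeZero m] {ι : Type} [Fintype ι] {Ω : Set Plane}

theorem eq_zero_of_ae_eq_zero_on_subTriangle (M : Mesh m ι Ω) (hm : m = 3 ∨ m = 4) {u : DispL2 Ω}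
    (h : ∀ p : ι × Fin m, ∀ᵐ x ∂(volume.restrict Ω), x ∈ subTriangle M.vert p.1 p.2 → u x = 0) :
    u = 0 := by
  refine (Lp.eq_zero_iff_ae_eq_zero).2 ?_
  filter_upwards [ae_all_iff.2 h, ae_restrict_mem M.isOpen_domain.measurableSet] with x hx hxΩ
  obtain ⟨p, hp⟩ := M.exists_mem_subTriangle_of_mem_domain hm hxΩ
  exact hx p hp

/-- The smoothed strain determines the discrete displacement. -/
theorem eq_zero_of_smoothed_strain_eq_zero (M : Mesh m ι Ω) (hm : m = 3 ∨ m = 4)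
    (hΩ : IsPreconnected Ω) {ΓD : Set Plane} (hΓD : ΓD ⊆ frontier Ω) (hΓm : MeasurableSet ΓD)
    (hpos : 0 < Measure.hausdorffMeasure 1 ΓD) (v : M.Vh ΓD)
    (hv : M.P₂ (M.P₁ (M.strainVh v)) = 0) : v = 0 := by
  obtain ⟨w, hw, hval, hΓ⟩ := v.2
  obtain ⟨A, hA, hPA⟩ := M.exists_isPiecewiseAffine hm hw
  have hconv : ∀ p : ι × Fin m, Convex ℝ (subTriangle M.vert p.1 p.2) :=
    fun p => convex_convexHull ℝ _
  have hint : ∀ p : ι × Fin m, interior (subTriangle M.vert p.1 p.2) ⊆ Ω := fun p =>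
    (interior_mono (M.subTriangle_subset p.1 p.2)).trans (M.interior_element_subset p.1)
  have hstrain : M.HasValues (M.strainVh v) fun p => symGrad (A p).linear := fun p =>
    strain_ae_eq_of_affine _ hval (hconv p) (hint p) (hA p)
  obtain ⟨E, hE, hEq, hsum⟩ := M.exists_hasValues_P₁ hm hstrain
  have hE0 := edge_average_eq_zero hm hPA hEq hsum (M.area_smul_add_eq_zero hm hE hv)
  have h0 := gradient_eq_zero hm hΩ hΓD hΓm hpos hΓ hPA fun p => by
    rw [hsum p, hE0 p, smul_zero]
  -- An element of `H1 Ω` carries its weak derivatives as data, so these must be shown to vanish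
  -- along with the field.
  refine Subtype.ext (Subtype.ext (Subtype.ext (Prod.ext ?_ (funext fun j => ?_))))
  · refine M.eq_zero_of_ae_eq_zero_on_subTriangle hm fun p => hval.mono fun x hx hxp => ?_
    exact hx.trans ((h0 p).2 x hxp)
  · refine M.eq_zero_of_ae_eq_zero_on_subTriangle hm fun p => ?_
    refine (partial_ae_eq_of_affine _ hval (hconv p) (hint p) (hA p) j).mono fun x hx hxp => ?_
    refine (hx hxp).trans ?_
    rw [(h0 p).1, LinearMap.zero_apply]

end Mesh

theorem mainTheorem4 (m : ℕ) [NeZero m] (hm : m = 3 ∨ m = 4)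
    (ι : Type) [Fintype ι] (Ω ΓD : Set Plane)
    (hΩ : IsConnected Ω)
    (hΓD_sub : ΓD ⊆ frontier Ω) (hΓD_meas : MeasurableSet ΓD)
    (hΓD_pos : 0 < Measure.hausdorffMeasure 1 ΓD)
    (M : Mesh m ι Ω)
    (D : Matrix (Fin 3) (Fin 3) ℝ) (hD : D.PosDef)
    (f : AdmissibleDisp Ω ΓD →L[ℝ] ℝ) :
    ∃ (u : M.Vh ΓD) (ε₁ : M.W₁) (ε₂ : M.W₂) (σ₁ : M.W₁) (σ₂ : M.W₂),
      M.IsGalerkinSolution D f u ε₁ ε₂ σ₁ σ₂ ∧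
      (∀ (u' : M.Vh ΓD) (ε₁' : M.W₁) (ε₂' : M.W₂) (σ₁' : M.W₁) (σ₂' : M.W₂),
        M.IsGalerkinSolution D f u' ε₁' ε₂' σ₁' σ₂' →
          u' = u ∧ ε₁' = ε₁ ∧ ε₂' = ε₂ ∧ σ₁' = σ₁ ∧ σ₂' = σ₂) ∧
      (ε₁ : StrainL2 Ω) = M.P₁ (M.strainVh u) ∧
      (ε₂ : StrainL2 Ω) = M.P₂ (M.P₁ (M.strainVh u)) ∧
      (σ₁ : StrainL2 Ω) = M.P₁ (M.P₂ (matMul D (M.P₂ (M.P₁ (M.strainVh u))))) ∧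
      (σ₂ : StrainL2 Ω) = matMul D (M.P₂ (M.P₁ (M.strainVh u))) ∧
      M.IsSSESolution D f u ∧
      (∀ w : M.Vh ΓD, M.IsSSESolution D f w → w = u) := by
  have hS₁ := M.isPartition_edgeSubdivision hm
  have hS₂ := M.isPartition_vertexSubdivision hm
  have hfin : FiniteDimensional ℝ M.W₂ := hS₂.finite_piecewiseConst
  -- The linear versions are kept opaque, known only by their values, so that the abstract
  -- conclusion rewrites back to the concrete operators.
  obtain ⟨P₁, hP₁⟩ : ∃ P : StrainL2 Ω →ₗ[ℝ] StrainL2 Ω, ∀ ε, P ε = M.P₁ ε :=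
    ⟨hS₁.smoothingₗ, fun _ => rfl⟩
  obtain ⟨P₂, hP₂⟩ : ∃ P : StrainL2 Ω →ₗ[ℝ] StrainL2 Ω, ∀ ε, P ε = M.P₂ ε :=
    ⟨hS₂.smoothingₗ, fun _ => rfl⟩
  obtain ⟨L, hL⟩ : ∃ L : StrainL2 Ω →ₗ[ℝ] StrainL2 Ω, ∀ ε, L ε = matMul D ε :=
    ⟨matMulₗ D, fun _ => rfl⟩
  obtain ⟨B, hB⟩ : ∃ B : M.Vh ΓD →ₗ[ℝ] StrainL2 Ω, ∀ v, B v = M.strainVh v :=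
    ⟨strainₗ ∘ₗ (AdmissibleDisp Ω ΓD).subtype ∘ₗ (M.Vh ΓD).subtype, fun _ => rfl⟩
  obtain ⟨F, hF⟩ : ∃ F : M.Vh ΓD →ₗ[ℝ] ℝ, ∀ v : M.Vh ΓD, F v = f v :=
    ⟨f.toLinearMap ∘ₗ (M.Vh ΓD).subtype, fun _ => rfl⟩
  have main := fiveField_solvable (K₁ := M.W₁) (K₂ := M.W₂) (P₁ := P₁) (P₂ := P₂) (D := L)
    (B := B) F
    (fun ε => by rw [hP₁]; exact hS₁.smoothing_mem ε)
    (fun ε => by rw [hP₂]; exact hS₂.smoothing_mem ε)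
    (fun ε δ hδ => by rw [hP₁]; exact hS₁.inner_smoothing ε hδ)
    (fun ε δ hδ => by rw [hP₂]; exact hS₂.inner_smoothing ε hδ)
    (fun ε h => by rw [hL]; exact matMul_mem_piecewiseConst D h)
    (fun ε h => by rw [hL] at h; exact eq_zero_of_inner_matMul hD h)
    (fun v hv => by
      rw [hP₁, hP₂, hB] at hv
      exact M.eq_zero_of_smoothed_strain_eq_zero hm hΩ.isPreconnected hΓD_sub hΓD_meas hΓD_pos v hv)
  simp only [hP₁, hP₂, hL, hB, hF, ← pairing_eq_inner] at main
  exact main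

end
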